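/- For a smooth vector field $v$ on $\mathbb R^3$ write $\omega=\operatorname{curl} v$ and, for $x\neq y$, $$\Phi(x,y)=\frac1{4\pi}\,\frac{\omega(x)\cdot\big((x-y)\times(v(y)\times\omega(y))\big)}{|x-y|^3}.$$ (i) Let $v:\mathbb R^3\to\mathbb R^3$ and $p:\mathbb R^3\to\mathbb R$ be smooth and solve the stationary Navier–Stokes equations $(v\cdot\nabla)v=-\nabla p+\Delta v$, $\operatorname{div}v=0$ on $\mathbb R^3$. If $|v(x)|\to0$ uniformly as $|x|\to\infty$ and $\omega\in L^{9/5}(\mathbb R^3)$, then $v=0$ on $\mathbb R^3$. (ii) There is an absolute constant $C<\infty$ such that every smooth vector field $v$ on $\mathbb R^3$ (solving the Navier–Stokes equations or not) with $\operatorname{div}v=0$, $|v(x)|\to0$ uniformly as $|x|\to\infty$ and $\omega\in L^{9/5}(\mathbb R^3)$ satisfies $$\|v\|_{L^{9/2}}\le C\,\|\omega\|_{L^{9/5}},$$ $\Phi$ is absolutely integrable on $\mathbb R^3\times\mathbb R^3$, and $$\int_{\mathbb R^3}\int_{\mathbb R^3}|\Phi(x,y)|\,dy\,dx\le C\,\|\omega\|_{L^{9/5}}^3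 .$$ -/

import Mathlib

open MeasureTheory Filter Topology
open scoped ENNReal NNReal ContDiff

/-- Three-dimensional Euclidean space. -/
abbrev E3 : Type := EuclideanSpace ℝ (Fin 3)

noncomputable section

namespace NavierStokes

/-- The vector product `a × b` on Euclidean space. -/
def cross (a b : E3) : E3 :=
  WithLp.toLp 2 (crossProduct a.ofLp b.ofLp)

/-- The partial derivative `∂ⱼ vᵢ` of the `i`-th component of `v`, at `x`. -/
def partialDeriv (v : E3 → E3) (j i : Fin 3) (x : E3) : ℝ :=
  (fderiv ℝ v x (EuclideanSpace.single j 1)) i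

/-- The divergence `∂₁ v₁ + ∂₂ v₂ + ∂₃ v₃`. -/
def div (v : E3 → E3) (x : E3) : ℝ :=
  ∑ i, partialDeriv v i i x

/-- The curl (vorticity) `(∂₂ v₃ - ∂₃ v₂, ∂₃ v₁ - ∂₁ v₃, ∂₁ v₂ - ∂₂ v₁)`. -/
def curl (v : E3 → E3) (x : E3) : E3 :=
  !₂[partialDeriv v 1 2 x - partialDeriv v 2 1 x,
     partialDeriv v 2 0 x - partialDeriv v 0 2 x,
     partialDeriv v 0 1 x - partialDeriv v 1 0 x]

/-- The convective term `(v · ∇) v`, with components `∑ⱼ vⱼ ∂ⱼ vᵢ`. -/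
def convection (v : E3 → E3) (x : E3) : E3 :=
  WithLp.toLp 2 fun i => ∑ j, v x j * partialDeriv v j i x

/-- `(v, p)` is a smooth solution of the stationary Navier-Stokes equations
`(v · ∇) v = -∇ p + Δ v`, `div v = 0` on the whole space. -/
structure IsSmoothStationarySolution (v : E3 → E3) (p : E3 → ℝ) : Prop where
  smooth_velocity : ContDiff ℝ ∞ v
  smooth_pressure : ContDiff ℝ ∞ p
  momentum : ∀ x, convection v x = -gradient p x + Laplacian.laplacian v x
  div_free : ∀ x, div v x = 0

/-- `|v(x)| → 0` uniformly as `|x| → ∞`. -/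
def VanishesAtInfinity (v : E3 → E3) : Prop :=
  ∀ ε > 0, ∃ R : ℝ, ∀ x, R ≤ ‖x‖ → ‖v x‖ < ε

/-- `Φ(x, y) = (1 / 4π) ω(x) · ((x - y) × (v(y) × ω(y))) / |x - y|³` with `ω = curl v`.
On the diagonal, a null set where the formula has no meaning, the value is `0`. -/
def Phi (v : E3 → E3) (x y : E3) : ℝ :=
  1 / (4 * Real.pi) *
    (inner ℝ (curl v x) (cross (x - y) (cross (v y) (curl v y))) / ‖x - y‖ ^ 3)

end NavierStokes

end

/-! Everything rests on one device that replaces the Biot-Savart formula. Let `radial 3` be the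
weight (1-|z|²)₊³. The vector field z (1-|z|²)₊³ is a multiple of the gradient of (1-|z|²)₊⁴, hence
L²-orthogonal to divergence-free fields at every scale. Write ∇f = F + W with div W = 0. The
fundamental theorem of calculus along the rays x + s z, averaged over z, then sees only F, and f(x)
differs from its average at scale R by at most a constant times `riesz |F|`
(`enorm_mass_mul_sub_le`).

With f = vᵢ, ∂ⱼvᵢ = (∂ⱼvᵢ - ∂ᵢvⱼ) + ∂ᵢvⱼ, and the last field is divergence free in j. Since v
vanishes at infinity the averages tend to 0, so |v| is controlled by the potential of |ω|
(`enorm_velocity_le`). The Hardy-Littlewood-Sobolev inequality (`exists_lintegral_mul_riesz_le`) and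
duality give the L^{9/2} bound. Hölder then puts v × ω in L^{9/7}, which is exactly what the same
inequality needs to bound the integral of |Φ|.

For the Liouville theorem take the total head H = p + |v|²/2, so that ∇H = v × ω - curl ω with curl
ω divergence free. The device applies again. Averages of H over large balls forget their centre, and
potentials of L^{9/7} functions have infimum 0, so H - a is bounded by the potential of |v × ω| for
some constant a. The identity |ω|² = div(v × ω - (H - a)v), tested against a cutoff at scale R,
bounds the integral of |ω|² over B_{R/2} by 1/R times the integral of |v × ω| + |H - a||v| over a
shell. The first term is O(R^{-1/3}) by Hölder. In the second, `exists_lintegral_mul_riesz_le` and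
Hölder on the shell produce a factor R that exactly cancels 1/R, and what remains is a tail of the
L^{9/2} norm of v, which tends to 0. Hence ω = 0, and the Biot-Savart estimate gives v = 0
(`curl_eq_zero`). -/

noncomputable section

namespace NavierStokes

/-! ### Hardy-Littlewood-Sobolev inequality for a layer-cake kernel -/

/-- The integral of `g` against the kernel `∫ₛ s⁻³ 1_{|x-y|<s} ds`, a multiple of `|x-y|⁻²`. -/
def riesz (g : E3 → ℝ≥0∞) (x : E3) : ℝ≥0∞ :=
  ∫⁻ s in Set.Ioi (0 : ℝ), ENNReal.ofReal (s ^ (-3 : ℝ)) * ∫⁻ y in Metric.ball x s, g y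

/-- The indicator of `|x-y| < c`. -/
def near (c : ℝ) (x y : E3) : ℝ≥0∞ := if dist x y < c then 1 else 0

lemma measurable_near : Measurable fun p : E3 × ℝ × E3 => near p.2.1 p.1 p.2.2 := by
  unfold near
  refine Measurable.ite (measurableSet_lt ?_ ?_) measurable_const measurable_const
  · exact (measurable_fst.dist (measurable_snd.comp measurable_snd))
  · exact measurable_fst.comp measurable_snd

lemma measurable_near_right (c : ℝ) (x : E3) : Measurable (near c x) := by
  unfold near
  exact Measurable.ite (measurableSet_lt (by fun_prop) measurable_const) measurable_const
    measurable_const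

lemma lintegral_ball_eq_near (g : E3 → ℝ≥0∞) (x : E3) (c : ℝ) :
    ∫⁻ y in Metric.ball x c, g y = ∫⁻ y, near c x y * g y := by
  rw [← lintegral_indicator Metric.isOpen_ball.measurableSet]
  refine lintegral_congr fun y => ?_
  by_cases h : dist x y < c
  · have h' : y ∈ Metric.ball x c := by rwa [Metric.mem_ball, dist_comm]
    simp [near, h, h']
  · have h' : y ∉ Metric.ball x c := by rwa [Metric.mem_ball, dist_comm]
    simp [near, h, h']

lemma volume_ball_eq (x : E3) {c : ℝ} (hc : 0 ≤ c) :
    volume (Metric.ball x c) = ENNReal.ofReal (c ^ 3) * volume (Metric.ball (0 : E3) 1) := by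
  rw [Measure.addHaar_ball volume x hc]; simp

lemma lintegral_near (x : E3) {c : ℝ} (hc : 0 ≤ c) :
    ∫⁻ y, near c x y = ENNReal.ofReal (c ^ 3) * volume (Metric.ball (0 : E3) 1) := by
  rw [← volume_ball_eq x hc]
  have := lintegral_ball_eq_near (fun _ => 1) x c
  simp only [mul_one, lintegral_const, one_mul] at this
  rw [← this]; simp

lemma near_comm (c : ℝ) (x y : E3) : near c x y = near c y x := by
  simp [near, dist_comm]

lemma lintegral_triple_swap {h : E3 → ℝ → E3 → ℝ≥0∞}
    (hh : Measurable fun p : E3 × ℝ × E3 => h p.1 p.2.1 p.2.2) :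
    ∫⁻ x, ∫⁻ c in Set.Ioi (0 : ℝ), ∫⁻ y, h x c y
      = ∫⁻ y, ∫⁻ c in Set.Ioi (0 : ℝ), ∫⁻ x, h x c y := by
  rw [lintegral_lintegral_swap]
  · have : ∀ c, ∫⁻ x, ∫⁻ y, h x c y = ∫⁻ y, ∫⁻ x, h x c y := fun c => by
      rw [lintegral_lintegral_swap]
      exact (hh.comp (measurable_fst.prodMk
        (measurable_const.prodMk measurable_snd))).aemeasurable
    simp_rw [this]
    rw [lintegral_lintegral_swap]
    refine Measurable.aemeasurable ?_
    refine Measurable.lintegral_prod_right' (f := fun q : (ℝ × E3) × E3 => h q.2 q.1.1 q.1.2) ?_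
    exact hh.comp (measurable_snd.prodMk measurable_fst)
  · refine Measurable.aemeasurable ?_
    refine Measurable.lintegral_prod_right' (f := fun q : (E3 × ℝ) × E3 => h q.1.1 q.1.2 q.2) ?_
    exact hh.comp ((measurable_fst.comp measurable_fst).prodMk
      ((measurable_snd.comp measurable_fst).prodMk measurable_snd))

/-- The part of `a ^ p * c ^ (-q)` where `c` is large. -/
def farPow (p q a c : ℝ) : ℝ≥0∞ := if 1 ≤ c * a then ENNReal.ofReal (a ^ p * c ^ (-q)) else 0

/-- The part of `a ^ 4 * c ^ (-3)` where `c` is small. -/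
def closePow (a c : ℝ) : ℝ≥0∞ := if c * a < 1 then ENNReal.ofReal (a ^ 4 * c ^ (-3 : ℝ)) else 0

lemma measurable_farPow (p q : ℝ) : Measurable fun z : ℝ × ℝ => farPow p q z.1 z.2 := by
  unfold farPow
  refine Measurable.ite (measurableSet_le ?_ ?_) ?_ ?_ <;> fun_prop

lemma measurable_closePow : Measurable fun z : ℝ × ℝ => closePow z.1 z.2 := by
  unfold closePow
  refine Measurable.ite (measurableSet_lt ?_ ?_) ?_ ?_ <;> fun_prop

/-- Only c ≥ 1/a contributes, and the tail of c^{-q} beyond 1/a is a^{q-1}/(q-1). -/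
lemma lintegral_farPow_le {p q a : ℝ} (ha : 0 ≤ a) (hq : 1 < q) :
    ∫⁻ c in Set.Ioi (0 : ℝ), farPow p q a c ≤ ENNReal.ofReal (a ^ (p + q - 1) / (q - 1)) := by
  rcases ha.eq_or_lt with rfl | ha
  · simp [farPow, not_le.2 (zero_lt_one (α := ℝ))]
  have h1 : ∫⁻ c in Set.Ioi (0 : ℝ), farPow p q a c
      ≤ ∫⁻ c in Set.Ici (1 / a), ENNReal.ofReal (a ^ p * c ^ (-q)) := by
    refine (setLIntegral_le_lintegral _ _).trans ?_
    rw [← lintegral_indicator measurableSet_Ici]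
    refine lintegral_mono fun c => ?_
    by_cases h : 1 ≤ c * a
    · have : c ∈ Set.Ici (1 / a) := by rw [Set.mem_Ici, div_le_iff₀ ha]; exact h
      rw [Set.indicator_of_mem this]; simp [farPow, h]
    · simp [farPow, h]
  refine h1.trans ?_
  have ha' : 0 < 1 / a := by positivity
  rw [setLIntegral_congr Ioi_ae_eq_Ici.symm, ← ofReal_integral_eq_lintegral_ofReal]
  · refine ENNReal.ofReal_le_ofReal (le_of_eq ?_)
    rw [integral_const_mul, integral_Ioi_rpow_of_lt (by linarith) ha', one_div,
      Real.inv_rpow ha.le, ← Real.rpow_neg ha.le]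
    have : a ^ (p + q - 1) = a ^ p * a ^ (-(-q + 1)) := by
      rw [← Real.rpow_add ha]; congr 1; ring
    rw [this]
    have h2 : -q + 1 ≠ 0 := by linarith
    have h3 : q - 1 ≠ 0 := by linarith
    field_simp
    ring
  · exact (integrableOn_Ioi_rpow_of_lt (by linarith) ha').const_mul _
  · filter_upwards [ae_restrict_mem measurableSet_Ioi] with c hc
    have : 0 < c := ha'.trans hc
    simp only [Pi.zero_apply]; positivity

/-- The factor c³ is the volume of the ball of radius c, which uses up three powers of decay. -/
lemma ofReal_cube_mul_farPow {p q a c : ℝ} (hc : 0 < c) :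
    ENNReal.ofReal (c ^ 3) * farPow p (q + 3) a c = farPow p q a c := by
  unfold farPow
  split_ifs
  · rw [← ENNReal.ofReal_mul (by positivity)]
    congr 1
    rw [← Real.rpow_natCast, mul_left_comm, ← Real.rpow_add hc]
    congr 2; push_cast; ring
  · simp

/-- The volume factor cancels c^{-3}, leaving the constant a⁴ on an interval of length 1/a. -/
lemma lintegral_closePow_le {a : ℝ} (ha : 0 ≤ a) :
    ∫⁻ c in Set.Ioi (0 : ℝ), ENNReal.ofReal (c ^ 3) * closePow a c ≤ ENNReal.ofReal (a ^ 3) := by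
  rcases ha.eq_or_lt with rfl | ha
  · simp [closePow]
  have h1 : ∫⁻ c in Set.Ioi (0 : ℝ), ENNReal.ofReal (c ^ 3) * closePow a c
      ≤ ∫⁻ c in Set.Ioo 0 (1 / a), ENNReal.ofReal (a ^ 4) := by
    rw [← lintegral_indicator measurableSet_Ioi, ← lintegral_indicator measurableSet_Ioo]
    refine lintegral_mono fun c => ?_
    by_cases h0 : 0 < c
    · by_cases h : c * a < 1
      · have : c ∈ Set.Ioo 0 (1 / a) := ⟨h0, by rw [lt_div_iff₀ ha]; exact h⟩
        simp only [closePow, h, this, Set.mem_Ioi.2 h0, Set.indicator_of_mem, if_true]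
        rw [← ENNReal.ofReal_mul (by positivity)]
        refine ENNReal.ofReal_le_ofReal (le_of_eq ?_)
        rw [← Real.rpow_natCast c, mul_left_comm, ← Real.rpow_add h0]
        norm_num
      · exact (le_of_eq (by simp [Set.indicator, closePow, h])).trans zero_le
    · simp [h0]
  refine h1.trans ?_
  rw [setLIntegral_const, Real.volume_Ioo, ← ENNReal.ofReal_mul (by positivity)]
  refine ENNReal.ofReal_le_ofReal (le_of_eq ?_)
  field_simp
  ring

/-- The scale c is compared with 1/a and 1/b. Where ca < 1 one has a^{5/3} ≤ c^{-5/3}, and similarly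
for b, so in the first three cases only one of a, b survives, with total homogeneity 4. When both
are large, b^{7/3} ≤ b³ c^{2/3}, and the product term remains. After integration each term is linear
in the integrals of a³ and b³, or is their product. -/
lemma pointwise_kernel_bound {a b c : ℝ} (ha : 0 ≤ a) (hb : 0 ≤ b) (hc : 0 < c) :
    ENNReal.ofReal (a ^ (5 / 3 : ℝ) * b ^ (7 / 3 : ℝ) * c ^ (-3 : ℝ)) ≤
      closePow a c + closePow b c + farPow (5 / 3) (7 / 3 + 3) a c
        + farPow (7 / 3) (5 / 3 + 3) b c + farPow (5 / 3) (7 / 3) a c * ENNReal.ofReal (b ^ 3) := by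
  have hinv : ∀ {t p : ℝ}, 0 ≤ t → 0 ≤ p → c * t ≤ 1 → t ^ p ≤ c ^ (-p) := by
    intro t p ht hp h
    rw [Real.rpow_neg hc.le, ← one_div, le_div_iff₀ (by positivity), ← Real.mul_rpow ht hc.le]
    exact Real.rpow_le_one (by positivity) (by linarith) hp
  have hfour : ∀ {t : ℝ}, 0 ≤ t → t ^ (5 / 3 : ℝ) * t ^ (7 / 3 : ℝ) = t ^ 4 := by
    intro t ht
    rw [← Real.rpow_add_of_nonneg ht (by norm_num) (by norm_num), ← Real.rpow_natCast]
    norm_num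
  by_cases h1 : c * a < 1 <;> by_cases h2 : c * b < 1
  · rcases le_total b a with h | h
    · refine le_trans ?_ (le_trans (le_trans (le_trans le_self_add le_self_add) le_self_add)
        le_self_add)
      simp only [closePow, h1, if_true]
      refine ENNReal.ofReal_le_ofReal ?_
      rw [← hfour ha]
      gcongr
    · refine le_trans ?_ (le_trans (le_trans (le_trans le_add_self le_self_add) le_self_add)
        le_self_add)
      simp only [closePow, h2, if_true]
      refine ENNReal.ofReal_le_ofReal ?_
      rw [← hfour hb]
      gcongr
  · refine le_trans ?_ (le_trans le_add_self le_self_add)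
    simp only [farPow, not_lt.1 h2, if_true]
    refine ENNReal.ofReal_le_ofReal ?_
    have := hinv ha (p := 5 / 3) (by norm_num) h1.le
    calc a ^ (5 / 3 : ℝ) * b ^ (7 / 3 : ℝ) * c ^ (-3 : ℝ)
        ≤ c ^ (-(5 / 3) : ℝ) * b ^ (7 / 3 : ℝ) * c ^ (-3 : ℝ) := by gcongr
      _ = b ^ (7 / 3 : ℝ) * (c ^ (-(5 / 3) : ℝ) * c ^ (-3 : ℝ)) := by ring
      _ = _ := by rw [← Real.rpow_add hc]; congr 2; ring
  · refine le_trans ?_ (le_trans (le_trans le_add_self le_self_add) le_self_add)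
    simp only [farPow, not_lt.1 h1, if_true]
    refine ENNReal.ofReal_le_ofReal ?_
    have := hinv hb (p := 7 / 3) (by norm_num) h2.le
    calc a ^ (5 / 3 : ℝ) * b ^ (7 / 3 : ℝ) * c ^ (-3 : ℝ)
        ≤ a ^ (5 / 3 : ℝ) * c ^ (-(7 / 3) : ℝ) * c ^ (-3 : ℝ) := by gcongr
      _ = a ^ (5 / 3 : ℝ) * (c ^ (-(7 / 3) : ℝ) * c ^ (-3 : ℝ)) := by ring
      _ = _ := by rw [← Real.rpow_add hc]; congr 2; ring
  · refine le_trans ?_ le_add_self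
    simp only [farPow, not_lt.1 h1, if_true]
    rw [← ENNReal.ofReal_mul (by positivity)]
    refine ENNReal.ofReal_le_ofReal ?_
    have hb0 : 0 < b := by
      rcases hb.eq_or_lt with rfl | h
      · simp at h2
      · exact h
    have h3 : b ^ (7 / 3 : ℝ) ≤ b ^ 3 * c ^ (2 / 3 : ℝ) := by
      have h4 : 1 ≤ (c * b) ^ (2 / 3 : ℝ) := Real.one_le_rpow (not_lt.1 h2) (by norm_num)
      calc b ^ (7 / 3 : ℝ) ≤ b ^ (7 / 3 : ℝ) * (c * b) ^ (2 / 3 : ℝ) :=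
            le_mul_of_one_le_right (by positivity) h4
        _ = (b ^ (7 / 3 : ℝ) * b ^ (2 / 3 : ℝ)) * c ^ (2 / 3 : ℝ) := by
            rw [Real.mul_rpow hc.le hb]; ring
        _ = _ := by rw [← Real.rpow_add hb0, ← Real.rpow_natCast b]; norm_num
    calc a ^ (5 / 3 : ℝ) * b ^ (7 / 3 : ℝ) * c ^ (-3 : ℝ)
        ≤ a ^ (5 / 3 : ℝ) * (b ^ 3 * c ^ (2 / 3 : ℝ)) * c ^ (-3 : ℝ) := by gcongr
      _ = a ^ (5 / 3 : ℝ) * (c ^ (2 / 3 : ℝ) * c ^ (-3 : ℝ)) * b ^ 3 := by ring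
      _ = _ := by rw [← Real.rpow_add hc]; congr 3; norm_num

/-- Terms involving a single function are integrated over the ball in the other variable, which
yields its volume, and then over c. In the product term the restriction to the ball is dropped and
b³ is integrated over the whole space. -/
lemma lintegral_triple_le (a b : E3 → ℝ≥0) (ha : Measurable a) (hb : Measurable b) :
    ∫⁻ x, ∫⁻ c in Set.Ioi (0 : ℝ), ∫⁻ y, near c x y *
        ENNReal.ofReal ((a x : ℝ) ^ (5 / 3 : ℝ) * (b y : ℝ) ^ (7 / 3 : ℝ) * c ^ (-3 : ℝ)) ≤
      4 * volume (Metric.ball (0 : E3) 1) * ((∫⁻ x, (a x : ℝ≥0∞) ^ 3) + ∫⁻ x, (b x : ℝ≥0∞) ^ 3)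
        + (∫⁻ x, (a x : ℝ≥0∞) ^ 3) * ∫⁻ x, (b x : ℝ≥0∞) ^ 3 := by
  set κ := volume (Metric.ball (0 : E3) 1)
  have hofReal : ∀ t : ℝ≥0, ENNReal.ofReal ((t : ℝ) ^ 3) = (t : ℝ≥0∞) ^ 3 := fun t => by
    rw [ENNReal.ofReal_pow t.coe_nonneg, ENNReal.ofReal_coe_nnreal]
  have hnear := measurable_near
  have hcoe : ∀ {a : E3 → ℝ≥0}, Measurable a → ∀ {T : ℝ → ℝ → ℝ≥0∞},
      (Measurable fun z : ℝ × ℝ => T z.1 z.2) →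
      Measurable fun p : E3 × ℝ × E3 => T (a p.1) p.2.1 := fun {a} ha {T} hT =>
    hT.comp ((ha.coe_nnreal_real.comp measurable_fst).prodMk
      (measurable_fst.comp measurable_snd))
  have hcoe' : ∀ {a : E3 → ℝ≥0}, Measurable a → ∀ {T : ℝ → ℝ → ℝ≥0∞},
      (Measurable fun z : ℝ × ℝ => T z.1 z.2) →
      Measurable fun p : E3 × ℝ × E3 => T (a p.2.2) p.2.1 := fun {a} ha {T} hT =>
    hT.comp ((ha.coe_nnreal_real.comp (measurable_snd.comp measurable_snd)).prodMk
      (measurable_fst.comp measurable_snd))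
  have key : ∀ {a : E3 → ℝ≥0}, ∀ {T : ℝ → ℝ → ℝ≥0∞} (K : ℝ≥0∞), K ≠ ⊤ →
      (Measurable fun z : ℝ × ℝ => T z.1 z.2) →
      (∀ t : ℝ≥0, ∫⁻ c in Set.Ioi (0 : ℝ), ENNReal.ofReal (c ^ 3) * T t c
        ≤ K * ENNReal.ofReal ((t : ℝ) ^ 3)) →
      ∫⁻ x, ∫⁻ c in Set.Ioi (0 : ℝ), ∫⁻ y, near c x y * T (a x) c
        ≤ K * κ * ∫⁻ x, (a x : ℝ≥0∞) ^ 3 := by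
    intro a T K hK hT h
    have hκ : κ ≠ ⊤ := measure_ball_lt_top.ne
    rw [← lintegral_const_mul' _ _ (ENNReal.mul_ne_top hK hκ)]
    refine lintegral_mono fun x => ?_
    calc ∫⁻ c in Set.Ioi (0 : ℝ), ∫⁻ y, near c x y * T (a x) c
        = ∫⁻ c in Set.Ioi (0 : ℝ), κ * (ENNReal.ofReal (c ^ 3) * T (a x) c) := by
          refine setLIntegral_congr_fun measurableSet_Ioi fun c hc => ?_
          beta_reduce
          rw [lintegral_mul_const _ (measurable_near_right c x), lintegral_near x (le_of_lt hc)]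
          ring
      _ = κ * ∫⁻ c in Set.Ioi (0 : ℝ), ENNReal.ofReal (c ^ 3) * T (a x) c :=
          lintegral_const_mul' _ _ hκ
      _ ≤ κ * (K * ENNReal.ofReal ((a x : ℝ) ^ 3)) := by gcongr; exact h _
      _ = _ := by rw [hofReal]; ring
  have key' : ∀ {T : ℝ → ℝ → ℝ≥0∞} (K : ℝ≥0∞), K ≠ ⊤ →
      (Measurable fun z : ℝ × ℝ => T z.1 z.2) →
      (∀ t : ℝ≥0, ∫⁻ c in Set.Ioi (0 : ℝ), ENNReal.ofReal (c ^ 3) * T t c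
        ≤ K * ENNReal.ofReal ((t : ℝ) ^ 3)) →
      ∫⁻ x, ∫⁻ c in Set.Ioi (0 : ℝ), ∫⁻ y, near c x y * T (b y) c
        ≤ K * κ * ∫⁻ x, (b x : ℝ≥0∞) ^ 3 := by
    intro T K hK hT h
    rw [lintegral_triple_swap (h := fun x c y => near c x y * T (b y) c)
      (hnear.mul (hcoe' hb hT))]
    simp_rw [near_comm]
    exact key K hK hT h
  have hfar : ∀ {p q : ℝ} (K : ℝ), 0 ≤ p → 1 < q → p + q = 4 → 1 / (q - 1) ≤ K → ∀ t : ℝ≥0,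
      ∫⁻ c in Set.Ioi (0 : ℝ), farPow p q t c
        ≤ ENNReal.ofReal K * ENNReal.ofReal ((t : ℝ) ^ 3) := by
    intro p q K hp hq hpq hK t
    refine (lintegral_farPow_le t.coe_nonneg hq).trans ?_
    have h3 : p + q - 1 = (3 : ℕ) := by push_cast; linarith
    have hK0 : 0 ≤ K := le_trans (by have : 0 < q - 1 := by linarith
                                     positivity) hK
    rw [← ENNReal.ofReal_mul hK0, h3, Real.rpow_natCast]
    refine ENNReal.ofReal_le_ofReal ?_
    rw [div_eq_mul_one_div, mul_comm]
    exact mul_le_mul_of_nonneg_right hK (by positivity)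
  have hfar' : ∀ {p q : ℝ} (K : ℝ), 0 ≤ p → 1 < q → p + q = 4 → 1 / (q - 1) ≤ K → ∀ t : ℝ≥0,
      ∫⁻ c in Set.Ioi (0 : ℝ), ENNReal.ofReal (c ^ 3) * farPow p (q + 3) t c
        ≤ ENNReal.ofReal K * ENNReal.ofReal ((t : ℝ) ^ 3) := by
    intro p q K hp hq hpq hK t
    refine le_trans (le_of_eq ?_) (hfar K hp hq hpq hK t)
    exact setLIntegral_congr_fun measurableSet_Ioi fun c hc => ofReal_cube_mul_farPow hc
  have m1 : Measurable fun p : E3 × ℝ × E3 => near p.2.1 p.1 p.2.2 * closePow (a p.1) p.2.1 :=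
    hnear.mul (hcoe ha measurable_closePow)
  have m2 : Measurable fun p : E3 × ℝ × E3 => near p.2.1 p.1 p.2.2 * closePow (b p.2.2) p.2.1 :=
    hnear.mul (hcoe' hb measurable_closePow)
  have m3 : Measurable fun p : E3 × ℝ × E3 =>
      near p.2.1 p.1 p.2.2 * farPow (5 / 3) (7 / 3 + 3) (a p.1) p.2.1 :=
    hnear.mul (hcoe ha (measurable_farPow _ _))
  have m4 : Measurable fun p : E3 × ℝ × E3 =>
      near p.2.1 p.1 p.2.2 * farPow (7 / 3) (5 / 3 + 3) (b p.2.2) p.2.1 :=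
    hnear.mul (hcoe' hb (measurable_farPow _ _))
  have split : ∀ {f g : E3 → ℝ → E3 → ℝ≥0∞},
      (Measurable fun p : E3 × ℝ × E3 => f p.1 p.2.1 p.2.2) →
      ∫⁻ x, ∫⁻ c in Set.Ioi (0 : ℝ), ∫⁻ y, (f x c y + g x c y) =
      (∫⁻ x, ∫⁻ c in Set.Ioi (0 : ℝ), ∫⁻ y, f x c y)
        + ∫⁻ x, ∫⁻ c in Set.Ioi (0 : ℝ), ∫⁻ y, g x c y := by
    intro f g hf
    have hf2 : Measurable fun q : E3 × ℝ => ∫⁻ y, f q.1 q.2 y :=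
      Measurable.lintegral_prod_right' (f := fun q : (E3 × ℝ) × E3 => f q.1.1 q.1.2 q.2)
        (hf.comp ((measurable_fst.comp measurable_fst).prodMk
          ((measurable_snd.comp measurable_fst).prodMk measurable_snd)))
    rw [← lintegral_add_left hf2.lintegral_prod_right']
    refine lintegral_congr fun x => ?_
    rw [← lintegral_add_left (by exact hf2.comp (measurable_const.prodMk measurable_id))]
    refine lintegral_congr fun c => ?_
    rw [← lintegral_add_left (by
      exact hf.comp (measurable_const.prodMk (measurable_const.prodMk measurable_id)))]
  calc _ ≤ ∫⁻ x, ∫⁻ c in Set.Ioi (0 : ℝ), ∫⁻ y,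
        (near c x y * closePow (a x) c + (near c x y * closePow (b y) c
          + (near c x y * farPow (5 / 3) (7 / 3 + 3) (a x) c
          + (near c x y * farPow (7 / 3) (5 / 3 + 3) (b y) c
          + farPow (5 / 3) (7 / 3) (a x) c * (b y : ℝ≥0∞) ^ 3)))) := by
        refine lintegral_mono fun x => setLIntegral_mono' measurableSet_Ioi fun c hc =>
          lintegral_mono fun y => ?_
        have h1 : near c x y ≤ 1 := by unfold near; split_ifs <;> simp
        refine (mul_le_mul_right (pointwise_kernel_bound (a x).coe_nonneg (b y).coe_nonneg hc) _).trans ?_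
        rw [hofReal]
        simp only [mul_add, ← add_assoc]
        exact add_le_add le_rfl (mul_le_of_le_one_left' h1)
    _ ≤ 1 * κ * (∫⁻ x, (a x : ℝ≥0∞) ^ 3) + (1 * κ * (∫⁻ x, (b x : ℝ≥0∞) ^ 3)
        + (ENNReal.ofReal 1 * κ * (∫⁻ x, (a x : ℝ≥0∞) ^ 3)
        + (ENNReal.ofReal 2 * κ * (∫⁻ x, (b x : ℝ≥0∞) ^ 3)
        + (∫⁻ x, (a x : ℝ≥0∞) ^ 3) * ∫⁻ x, (b x : ℝ≥0∞) ^ 3))) := by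
        rw [split m1, split m2, split m3, split m4]
        gcongr
        · exact key 1 (by simp) measurable_closePow fun t => by
            rw [one_mul]; exact lintegral_closePow_le t.coe_nonneg
        · exact key' 1 (by simp) measurable_closePow fun t => by
            rw [one_mul]; exact lintegral_closePow_le t.coe_nonneg
        · exact key _ (by simp) (measurable_farPow _ _)
            (hfar' 1 (by norm_num) (by norm_num) (by norm_num) (by norm_num))
        · exact key' _ (by simp) (measurable_farPow _ _)
            -- Here q = 5/3, so 1/(q-1) = 3/2 is rounded up to 2; for q = 7/3 the value 3/4 was
            -- rounded up to 1.
            (hfar' 2 (by norm_num) (by norm_num) (by norm_num) (by norm_num))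
        · have hb3 : Measurable fun y => (b y : ℝ≥0∞) ^ 3 := hb.coe_nnreal_ennreal.pow_const 3
          have hT : ∀ x, Measurable fun c => farPow (5 / 3) (7 / 3) (a x) c := fun x =>
            (measurable_farPow _ _).comp (measurable_const.prodMk measurable_id)
          simp_rw [lintegral_const_mul _ hb3]
          simp_rw [fun x => lintegral_mul_const (μ := volume.restrict (Set.Ioi (0 : ℝ)))
            (∫⁻ y, (b y : ℝ≥0∞) ^ 3) (hT x)]
          refine (lintegral_mono fun x => mul_le_mul_left (hfar 1 (by norm_num) (by norm_num)
            (by norm_num) (by norm_num) (a x)) _).trans ?_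
          simp only [ENNReal.ofReal_one, one_mul, hofReal]
          rw [lintegral_mul_const _ (ha.coe_nnreal_ennreal.pow_const 3)]
    _ ≤ _ := by
        simp only [ENNReal.ofReal_one, one_mul, ENNReal.ofReal_ofNat]
        generalize ∫⁻ x, (a x : ℝ≥0∞) ^ 3 = A
        generalize ∫⁻ x, (b x : ℝ≥0∞) ^ 3 = B
        have : κ * A + (κ * B + (κ * A + (2 * κ * B + A * B)))
            = 2 * (κ * A) + 3 * (κ * B) + A * B := by ring
        rw [this, mul_add, mul_assoc, mul_assoc]
        gcongr <;> norm_num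

lemma lintegral_mul_riesz (f g : E3 → ℝ≥0) :
    ∫⁻ x, f x * riesz (fun y => g y) x = ∫⁻ x, ∫⁻ c in Set.Ioi (0 : ℝ), ∫⁻ y,
      near c x y * ENNReal.ofReal ((f x : ℝ) * (g y : ℝ) * c ^ (-3 : ℝ)) := by
  refine lintegral_congr fun x => ?_
  unfold riesz
  rw [← lintegral_const_mul' _ _ ENNReal.coe_ne_top]
  refine setLIntegral_congr_fun measurableSet_Ioi fun c hc => ?_
  beta_reduce
  rw [lintegral_ball_eq_near, ← lintegral_const_mul' _ _ ENNReal.ofReal_ne_top,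
    ← lintegral_const_mul' _ _ ENNReal.coe_ne_top]
  refine lintegral_congr fun y => ?_
  rw [ENNReal.ofReal_mul (by positivity), ENNReal.ofReal_mul (by positivity),
    ENNReal.ofReal_coe_nnreal, ENNReal.ofReal_coe_nnreal]
  ring

lemma riesz_congr_ae {g h : E3 → ℝ≥0∞} (H : g =ᵐ[volume] h) : riesz g = riesz h := by
  ext x
  unfold riesz
  congr 1
  ext c
  congr 1
  exact lintegral_congr_ae (ae_restrict_of_ae H)

@[simp] lemma riesz_zero : riesz (fun _ => 0) = fun _ => 0 := by
  ext x; simp [riesz]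

/-- The Hardy-Littlewood-Sobolev inequality for the kernel `|x-y|⁻²` and the exponents
`9/5`, `9/7`. -/
theorem exists_lintegral_mul_riesz_le : ∃ C : ℝ≥0, ∀ f g : E3 → ℝ≥0, Measurable f → Measurable g →
    ∫⁻ x, f x * riesz (fun y => g y) x ≤
      C * (∫⁻ x, (f x : ℝ≥0∞) ^ (9 / 5 : ℝ)) ^ (5 / 9 : ℝ)
        * (∫⁻ x, (g x : ℝ≥0∞) ^ (9 / 7 : ℝ)) ^ (7 / 9 : ℝ) := by
  have hκ : volume (Metric.ball (0 : E3) 1) ≠ ⊤ := measure_ball_lt_top.ne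
  -- This is the bound of `lintegral_triple_le` when both cubes have integral 1.
  refine ⟨8 * (volume (Metric.ball (0 : E3) 1)).toNNReal + 1, fun f g hf hg => ?_⟩
  set C : ℝ≥0 := 8 * (volume (Metric.ball (0 : E3) 1)).toNNReal + 1 with hC
  have hCpos : (C : ℝ≥0∞) ≠ 0 := by rw [hC]; positivity
  have hzero : ∀ {f : E3 → ℝ≥0} {p q : ℝ}, Measurable f → 0 < p → 0 < q →
      (∫⁻ x, (f x : ℝ≥0∞) ^ p) ^ q = 0 → (fun x => (f x : ℝ≥0∞)) =ᵐ[volume] fun _ => 0 := by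
    intro f p q hf hp hq h
    rw [ENNReal.rpow_eq_zero_iff_of_pos hq,
      lintegral_eq_zero_iff (hf.coe_nnreal_ennreal.pow_const p)] at h
    filter_upwards [h] with x hx
    simpa [hp, hp.le, hp.not_gt] using hx
  -- Norms equal to 0 or ∞ are removed first, since the normalisation below divides by them.
  by_cases hA0 : (∫⁻ x, (f x : ℝ≥0∞) ^ (9 / 5 : ℝ)) ^ (5 / 9 : ℝ) = 0
  · have : ∫⁻ x, f x * riesz (fun y => g y) x = ∫⁻ x : E3, 0 :=
      lintegral_congr_ae (by
        filter_upwards [hzero hf (by norm_num) (by norm_num) hA0] with x hx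
        rw [hx, zero_mul])
    rw [this]; simp
  by_cases hB0 : (∫⁻ x, (g x : ℝ≥0∞) ^ (9 / 7 : ℝ)) ^ (7 / 9 : ℝ) = 0
  · rw [riesz_congr_ae (hzero hg (by norm_num) (by norm_num) hB0)]; simp
  by_cases hA : (∫⁻ x, (f x : ℝ≥0∞) ^ (9 / 5 : ℝ)) ^ (5 / 9 : ℝ) = ⊤
  · rw [hA, ENNReal.mul_top hCpos, ENNReal.top_mul hB0]; exact le_top
  by_cases hB : (∫⁻ x, (g x : ℝ≥0∞) ^ (9 / 7 : ℝ)) ^ (7 / 9 : ℝ) = ⊤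
  · rw [hB, ENNReal.mul_top (mul_ne_zero hCpos hA0)]; exact le_top
  obtain ⟨A, hA'⟩ : ∃ A : ℝ≥0, (A : ℝ≥0∞) = (∫⁻ x, (f x : ℝ≥0∞) ^ (9 / 5 : ℝ)) ^ (5 / 9 : ℝ) :=
    ⟨_, ENNReal.coe_toNNReal hA⟩
  obtain ⟨B, hB'⟩ : ∃ B : ℝ≥0, (B : ℝ≥0∞) = (∫⁻ x, (g x : ℝ≥0∞) ^ (9 / 7 : ℝ)) ^ (7 / 9 : ℝ) :=
    ⟨_, ENNReal.coe_toNNReal hB⟩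
  rw [← hA', ← hB']
  have hApos : A ≠ 0 := by rintro rfl; exact hA0 (by rw [← hA']; simp)
  have hBpos : B ≠ 0 := by rintro rfl; exact hB0 (by rw [← hB']; simp)
  have hnorm : ∀ {f : E3 → ℝ≥0} {A : ℝ≥0} {p : ℝ}, Measurable f → A ≠ 0 → 0 < p →
      (A : ℝ≥0∞) = (∫⁻ x, (f x : ℝ≥0∞) ^ p) ^ (1 / p) →
      ∫⁻ x, (((f x / A) ^ (p / 3) : ℝ≥0) : ℝ≥0∞) ^ 3 = 1 := by
    intro f A p hf hA hp h
    have h1 : ∀ x, (((f x / A) ^ (p / 3) : ℝ≥0) : ℝ≥0∞) ^ 3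
        = ((A : ℝ≥0∞) ^ p)⁻¹ * (f x : ℝ≥0∞) ^ p := by
      intro x
      rw [← ENNReal.coe_pow, ← NNReal.rpow_mul_natCast,
        show p / 3 * ((3 : ℕ) : ℝ) = p by push_cast; ring, NNReal.div_rpow,
        ENNReal.coe_div (by simp [hA, hp.ne']), ENNReal.coe_rpow_of_nonneg _ hp.le,
        ENNReal.coe_rpow_of_nonneg _ hp.le, div_eq_mul_inv, mul_comm]
    simp_rw [h1]
    have h2 : (A : ℝ≥0∞) ^ p = ∫⁻ x, (f x : ℝ≥0∞) ^ p := by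
      rw [h, ← ENNReal.rpow_mul, one_div_mul_cancel hp.ne', ENNReal.rpow_one]
    have h3 : (A : ℝ≥0∞) ^ p ≠ 0 := by
      rw [ne_eq, ENNReal.rpow_eq_zero_iff_of_pos hp]; simpa using hA
    have h4 : (A : ℝ≥0∞) ^ p ≠ ⊤ := ENNReal.rpow_ne_top_of_nonneg hp.le ENNReal.coe_ne_top
    rw [lintegral_const_mul' _ _ (ENNReal.inv_ne_top.2 h3), ← h2, ENNReal.inv_mul_cancel h3 h4]
  have hrec : ∀ {f : E3 → ℝ≥0} {A : ℝ≥0} {p q : ℝ}, A ≠ 0 → p * q = 1 → ∀ x,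
      (f x : ℝ) = A * ((((f x / A) ^ p : ℝ≥0) : ℝ) ^ q) := by
    intro f A p q hA hpq x
    rw [← NNReal.coe_rpow, ← NNReal.rpow_mul, hpq, NNReal.rpow_one, ← NNReal.coe_mul,
      mul_div_cancel₀ _ hA]
  -- These powers make a³ and b³ of integral 1, with f = A a^{5/3} and g = B b^{7/3}.
  set a : E3 → ℝ≥0 := fun x => (f x / A) ^ (9 / 5 / 3 : ℝ) with ha
  set b : E3 → ℝ≥0 := fun x => (g x / B) ^ (9 / 7 / 3 : ℝ) with hb
  have ha1 : ∫⁻ x, (a x : ℝ≥0∞) ^ 3 = 1 := hnorm hf hApos (by norm_num) (by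
    rw [hA']; norm_num)
  have hb1 : ∫⁻ x, (b x : ℝ≥0∞) ^ 3 = 1 := hnorm hg hBpos (by norm_num) (by
    rw [hB']; norm_num)
  have hab := lintegral_triple_le a b ((hf.div_const A).pow_const _) ((hg.div_const B).pow_const _)
  rw [ha1, hb1] at hab
  rw [lintegral_mul_riesz f g]
  have h5 : ∀ x c y, near c x y * ENNReal.ofReal ((f x : ℝ) * (g y : ℝ) * c ^ (-3 : ℝ))
      = (A * B : ℝ≥0) * (near c x y * ENNReal.ofReal
        ((a x : ℝ) ^ (5 / 3 : ℝ) * (b y : ℝ) ^ (7 / 3 : ℝ) * c ^ (-3 : ℝ))) := by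
    intro x c y
    rw [hrec (f := f) hApos (p := 9 / 5 / 3) (q := 5 / 3) (by norm_num) x,
      hrec (f := g) hBpos (p := 9 / 7 / 3) (q := 7 / 3) (by norm_num) y]
    change _ * ENNReal.ofReal ((A : ℝ) * (a x : ℝ) ^ (5 / 3 : ℝ) *
      (B * (b y : ℝ) ^ (7 / 3 : ℝ)) * c ^ (-3 : ℝ)) = _
    rw [← ENNReal.ofReal_coe_nnreal (p := A * B), mul_left_comm (ENNReal.ofReal _) (near c x y),
      ← ENNReal.ofReal_mul (by positivity)]
    congr 2
    push_cast
    ring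
  simp_rw [h5, lintegral_const_mul' _ _ ENNReal.coe_ne_top]
  refine (mul_le_mul_right hab _).trans ?_
  have h6 : (C : ℝ≥0∞) = 8 * volume (Metric.ball (0 : E3) 1) + 1 := by
    rw [hC]; push_cast; rw [ENNReal.coe_toNNReal hκ]
  rw [h6]
  push_cast
  refine le_of_eq ?_
  ring

/-! ### Calculus of scalar partial derivatives and scaled test functions -/

/-- The partial derivative `∂ⱼ f` of a scalar function. -/
def pd (j : Fin 3) (f : E3 → ℝ) (x : E3) : ℝ := fderiv ℝ f x (EuclideanSpace.single j 1)

lemma HasFDerivAt.pd_eq {f : E3 → ℝ} {f' : E3 →L[ℝ] ℝ} {x : E3} (h : HasFDerivAt f f' x)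
    (j : Fin 3) : pd j f x = f' (EuclideanSpace.single j 1) := by
  rw [pd, h.fderiv]

lemma fderiv_apply_eq_sum_pd (f : E3 → ℝ) (x h : E3) :
    fderiv ℝ f x h = ∑ j, h j * pd j f x := by
  conv_lhs => rw [← (EuclideanSpace.basisFun (Fin 3) ℝ).sum_repr h]
  simp [pd]

lemma continuous_pd {f : E3 → ℝ} (hf : ContDiff ℝ 1 f) (j : Fin 3) : Continuous (pd j f) :=
  (hf.continuous_fderiv one_ne_zero).clm_apply continuous_const

lemma contDiff_pd {f : E3 → ℝ} (hf : ContDiff ℝ ∞ f) (j : Fin 3) : ContDiff ℝ ∞ (pd j f) :=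
  (hf.fderiv_right (m := ∞) (by simp)).clm_apply contDiff_const

lemma pd_add {f g : E3 → ℝ} (hf : ContDiff ℝ 1 f) (hg : ContDiff ℝ 1 g) (j : Fin 3) (x : E3) :
    pd j (fun y => f y + g y) x = pd j f x + pd j g x := by
  rw [HasFDerivAt.pd_eq (((hf.differentiable one_ne_zero) x).hasFDerivAt.fun_add
    ((hg.differentiable one_ne_zero) x).hasFDerivAt)]
  rfl

lemma pd_sub {f g : E3 → ℝ} (hf : ContDiff ℝ 1 f) (hg : ContDiff ℝ 1 g) (j : Fin 3) (x : E3) :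
    pd j (fun y => f y - g y) x = pd j f x - pd j g x := by
  rw [HasFDerivAt.pd_eq (((hf.differentiable one_ne_zero) x).hasFDerivAt.fun_sub
    ((hg.differentiable one_ne_zero) x).hasFDerivAt)]
  rfl

lemma pd_mul {f g : E3 → ℝ} (hf : ContDiff ℝ 1 f) (hg : ContDiff ℝ 1 g) (j : Fin 3) (x : E3) :
    pd j (fun y => f y * g y) x = f x * pd j g x + g x * pd j f x := by
  rw [HasFDerivAt.pd_eq (f := fun y => f y * g y)
    (((hf.differentiable one_ne_zero) x).hasFDerivAt.mul
      ((hg.differentiable one_ne_zero) x).hasFDerivAt)]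
  rfl

lemma pd_const (c : ℝ) (j : Fin 3) (x : E3) : pd j (fun _ => c) x = 0 := by
  simp [pd]

lemma pd_const_mul {f : E3 → ℝ} (hf : ContDiff ℝ 1 f) (c : ℝ) (j : Fin 3) (x : E3) :
    pd j (fun y => c * f y) x = c * pd j f x := by
  rw [pd_mul contDiff_const hf, pd_const, mul_zero, add_zero]

lemma pd_pd_eq {f : E3 → ℝ} (hf : ContDiff ℝ ∞ f) (i j : Fin 3) (x : E3) :
    pd i (pd j f) x = fderiv ℝ (fderiv ℝ f) x (EuclideanSpace.single i 1)
      (EuclideanSpace.single j 1) := by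
  have hd : HasFDerivAt (fderiv ℝ f) (fderiv ℝ (fderiv ℝ f) x) x :=
    (((hf.fderiv_right (m := ∞) (by simp)).differentiable (by simp)) x).hasFDerivAt
  have := hd.clm_apply (hasFDerivAt_const (EuclideanSpace.single j (1 : ℝ)) x)
  rw [HasFDerivAt.pd_eq (f := pd j f) this]
  simp

lemma pd_comm {f : E3 → ℝ} (hf : ContDiff ℝ ∞ f) (i j : Fin 3) (x : E3) :
    pd i (pd j f) x = pd j (pd i f) x := by
  rw [pd_pd_eq hf, pd_pd_eq hf]
  exact ((hf.of_le (n := ∞) (m := 2) (WithTop.coe_le_coe.2 le_top)).contDiffAt.isSymmSndFDerivAt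
    (by simp)) _ _

lemma contDiff_affine {f : E3 → ℝ} {n : ℕ∞ω} (hf : ContDiff ℝ n f) (x : E3) (s : ℝ) :
    ContDiff ℝ n fun z => f (x + s • z) :=
  hf.comp (by fun_prop)

lemma pd_affine {f : E3 → ℝ} (hf : ContDiff ℝ 1 f) (x : E3) (s : ℝ) (j : Fin 3) (z : E3) :
    pd j (fun z => f (x + s • z)) z = s * pd j f (x + s • z) := by
  have h1 : HasFDerivAt (fun z : E3 => x + s • z) (s • ContinuousLinearMap.id ℝ E3) z :=
    ((hasFDerivAt_id z).const_smul s).const_add x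
  have h2 := ((hf.differentiable one_ne_zero) (x + s • z)).hasFDerivAt
  rw [HasFDerivAt.pd_eq (f := fun z => f (x + s • z)) (h2.comp z h1)]
  simp [pd]

lemma integral_mul_pd {φ f : E3 → ℝ} (hφ : ContDiff ℝ 1 φ) (hc : HasCompactSupport φ)
    (hf : ContDiff ℝ 1 f) (j : Fin 3) :
    ∫ z, φ z * pd j f z = -∫ z, pd j φ z * f z := by
  have hc' : HasCompactSupport (pd j φ) := hc.fderiv_apply (𝕜 := ℝ) _
  refine integral_mul_fderiv_eq_neg_fderiv_mul_of_integrable ?_ ?_ ?_ ?_ ?_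
  · exact ((continuous_pd hφ j).mul hf.continuous).integrable_of_hasCompactSupport hc'.mul_right
  · exact (hφ.continuous.mul (continuous_pd hf j)).integrable_of_hasCompactSupport hc.mul_right
  · exact (hφ.continuous.mul hf.continuous).integrable_of_hasCompactSupport hc.mul_right
  · exact fun x _ => hφ.differentiable one_ne_zero x
  · exact fun x _ => hf.differentiable one_ne_zero x

/-- The divergence theorem, tested against a compactly supported function at scale `s`. -/
lemma integral_mul_div {φ : E3 → ℝ} (hφ : ContDiff ℝ 1 φ) (hc : HasCompactSupport φ)
    {w : Fin 3 → E3 → ℝ} (hw : ∀ j, ContDiff ℝ 1 (w j)) (x : E3) (s : ℝ) :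
    s * ∫ z, φ z * ∑ j, pd j (w j) (x + s • z) = -∫ z, ∑ j, pd j φ z * w j (x + s • z) := by
  have hc' : ∀ j, HasCompactSupport (pd j φ) := fun j => hc.fderiv_apply (𝕜 := ℝ) _
  have hcont : Continuous fun z : E3 => x + s • z := by fun_prop
  have i1 : ∀ j, Integrable fun z => pd j φ z * w j (x + s • z) := fun j =>
    ((continuous_pd hφ j).mul ((hw j).continuous.comp hcont)).integrable_of_hasCompactSupport
      (hc' j).mul_right
  have i2 : ∀ j, Integrable fun z => φ z * pd j (w j) (x + s • z) := fun j =>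
    (hφ.continuous.mul ((continuous_pd (hw j) j).comp hcont)).integrable_of_hasCompactSupport
      hc.mul_right
  simp_rw [Finset.mul_sum]
  rw [integral_finsetSum _ fun j _ => i1 j, integral_finsetSum _ fun j _ => i2 j,
    Finset.mul_sum, ← Finset.sum_neg_distrib]
  refine Finset.sum_congr rfl fun j _ => ?_
  rw [← integral_mul_pd hφ hc (contDiff_affine (hw j) x s), ← integral_const_mul]
  refine integral_congr_ae (ae_of_all _ fun z => ?_)
  simp only [pd_affine (hw j)]
  ring

/-- The fundamental theorem of calculus along the segments `e z + s • d z`, averaged over `z`. -/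
lemma integral_bump_sub {ψ : E3 → ℝ} (hψ : Continuous ψ) (hc : HasCompactSupport ψ)
    {f : E3 → ℝ} (hf : ContDiff ℝ 1 f) {e d : E3 → E3} (he : Continuous e) (hd : Continuous d)
    (R : ℝ) :
    (∫ z, ψ z * f (e z + R • d z)) - ∫ z, ψ z * f (e z) =
      ∫ s in (0 : ℝ)..R, ∫ z, ψ z * ∑ j, d z j * pd j f (e z + s • d z) := by
  have hdc : ∀ j, Continuous fun z => d z j := fun j =>
    (EuclideanSpace.proj (𝕜 := ℝ) j).continuous.comp hd
  have hint : ∀ {g : E3 → ℝ}, Continuous g → Integrable fun z => ψ z * g z := fun hg =>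
    (hψ.mul hg).integrable_of_hasCompactSupport hc.mul_right
  have i1 : Integrable fun z => ψ z * f (e z + R • d z) := hint (hf.continuous.comp (by fun_prop))
  have i2 : Integrable fun z => ψ z * f (e z) := hint (hf.continuous.comp he)
  rw [← integral_sub i1 i2, intervalIntegral_integral_swap]
  · refine integral_congr_ae (ae_of_all _ fun z => ?_)
    beta_reduce
    rw [intervalIntegral.integral_const_mul, ← mul_sub]
    congr 1
    have hder : ∀ s ∈ Set.uIcc 0 R, HasDerivAt (fun s : ℝ => f (e z + s • d z))
        (∑ j, d z j * pd j f (e z + s • d z)) s := by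
      intro s _
      rw [← fderiv_apply_eq_sum_pd]
      have h1 : HasDerivAt (fun s : ℝ => e z + s • d z) (d z) s := by
        simpa using ((hasDerivAt_id s).smul_const (d z)).const_add (e z)
      exact ((hf.differentiable one_ne_zero _).hasFDerivAt).comp_hasDerivAt s h1
    rw [intervalIntegral.integral_eq_sub_of_hasDerivAt hder]
    · simp
    · refine Continuous.intervalIntegrable ?_ _ _
      exact continuous_finsetSum _ fun j _ => continuous_const.mul
        ((continuous_pd hf j).comp (by fun_prop))
  · have hcont : Continuous (Function.uncurry fun (s : ℝ) (z : E3) =>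
        ψ z * ∑ j, d z j * pd j f (e z + s • d z)) := by
      refine (hψ.comp continuous_snd).mul (continuous_finsetSum _ fun j _ =>
        ((hdc j).comp continuous_snd).mul ((continuous_pd hf j).comp ?_))
      exact (he.comp continuous_snd).add (continuous_fst.smul (hd.comp continuous_snd))
    have hon : IntegrableOn (Function.uncurry fun (s : ℝ) (z : E3) =>
        ψ z * ∑ j, d z j * pd j f (e z + s • d z)) (Set.uIcc 0 R ×ˢ tsupport ψ)
        (volume.prod volume) :=
      hcont.continuousOn.integrableOn_compact (isCompact_uIcc.prod hc)
    have h2 : IntegrableOn (Function.uncurry fun (s : ℝ) (z : E3) =>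
        ψ z * ∑ j, d z j * pd j f (e z + s • d z)) (Set.uIcc 0 R ×ˢ Set.univ)
        (volume.prod volume) := by
      refine hon.of_forall_sdiff_eq_zero (measurableSet_uIcc.prod MeasurableSet.univ) ?_
      rintro ⟨s, z⟩ ⟨⟨h1, -⟩, h3⟩
      have : z ∉ tsupport ψ := fun h => h3 ⟨h1, h⟩
      simp [Function.uncurry, image_eq_zero_of_notMem_tsupport this]
    rw [← Measure.restrict_univ (μ := (volume : Measure E3)), Measure.prod_restrict]
    exact h2.mono_set (Set.prod_mono Set.uIoc_subset_uIcc le_rfl)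

/-- The Jacobian of y = x + s z is the origin of the weight s⁻³ in `riesz`: integrating unit-ball
averages over all scales s gives the potential. -/
lemma lintegral_ball_affine {g : E3 → ℝ≥0∞} (hg : Measurable g) (x : E3) {s : ℝ} (hs : 0 < s) :
    ∫⁻ z in Metric.ball (0 : E3) 1, g (x + s • z)
      = ENNReal.ofReal (s ^ (-3 : ℝ)) * ∫⁻ y in Metric.ball x s, g y := by
  rw [← lintegral_indicator Metric.isOpen_ball.measurableSet,
    ← lintegral_indicator Metric.isOpen_ball.measurableSet]
  set G := (Metric.ball x s).indicator g with hG
  have hGm : Measurable G := hg.indicator Metric.isOpen_ball.measurableSet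
  have h1 : ∀ z, (Metric.ball (0 : E3) 1).indicator (fun z => g (x + s • z)) z
      = G (x + s • z) := by
    intro z
    simp only [hG, Set.indicator, Metric.mem_ball, dist_self_add_left, dist_zero_right, norm_smul,
      Real.norm_eq_abs, abs_of_pos hs]
    have : s * ‖z‖ < s ↔ ‖z‖ < 1 := by
      rw [mul_comm, mul_lt_iff_lt_one_left hs]
    simp only [this]
  simp_rw [h1]
  have h2 : (∫⁻ z, G (x + z)) = ∫⁻ y, G y := lintegral_add_left_eq_self G x
  rw [← h2]
  have h3 : ∫⁻ z, G (x + z) ∂(Measure.map (fun z : E3 => s • z) volume)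
      = ∫⁻ z, G (x + s • z) := by
    rw [lintegral_map (f := fun z => G (x + z)) (hGm.comp (measurable_const_add x))
      (measurable_const_smul s)]
  rw [← h3, Measure.map_addHaar_smul volume hs.ne', lintegral_smul_measure, smul_eq_mul]
  congr 2
  rw [abs_of_pos (by positivity), Real.rpow_neg hs.le, ← Real.rpow_natCast]
  simp

/-! ### The radial weight and averages over balls -/

lemma hasDerivAt_max_zero_pow (n : ℕ) (t : ℝ) :
    HasDerivAt (fun t : ℝ => max t 0 ^ (n + 2)) ((n + 2) * max t 0 ^ (n + 1)) t := by
  rcases lt_trichotomy t 0 with h | rfl | h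
  · have h1 : (fun t : ℝ => max t 0 ^ (n + 2)) =ᶠ[𝓝 t] fun _ => 0 := by
      filter_upwards [Iio_mem_nhds h] with s hs
      simp [max_eq_right (le_of_lt (Set.mem_Iio.1 hs))]
    rw [max_eq_right h.le]
    simpa using (hasDerivAt_const t (0 : ℝ)).congr_of_eventuallyEq h1
  · rw [hasDerivAt_iff_isLittleO_nhds_zero]
    simp only [zero_add, max_self, ne_eq, Nat.add_eq_zero_iff, OfNat.ofNat_ne_zero, and_false,
      not_false_eq_true, zero_pow, sub_zero, one_ne_zero, mul_zero, smul_zero]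
    have h2 : (fun h : ℝ => max h 0 ^ (n + 2)) =O[𝓝 0] fun h : ℝ => h ^ (n + 2) := by
      refine Asymptotics.IsBigO.of_bound 1 (Eventually.of_forall fun h => ?_)
      rw [one_mul, norm_pow, norm_pow]
      gcongr
      rw [Real.norm_eq_abs, Real.norm_eq_abs, abs_of_nonneg (le_max_right _ _)]
      exact max_le (le_abs_self h) (abs_nonneg h)
    have h3 := Asymptotics.isLittleO_pow_id (𝕜 := ℝ) (n := n + 2) (by omega)
    exact h2.trans_isLittleO h3
  · have h1 : (fun t : ℝ => max t 0 ^ (n + 2)) =ᶠ[𝓝 t] fun t => t ^ (n + 2) := by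
      filter_upwards [Ioi_mem_nhds h] with s hs
      rw [max_eq_left (le_of_lt (Set.mem_Ioi.1 hs))]
    rw [max_eq_left h.le]
    have := (hasDerivAt_pow (n + 2) t).congr_of_eventuallyEq h1
    simpa using this

lemma contDiff_max_zero_pow (n : ℕ) : ContDiff ℝ 1 fun t : ℝ => max t 0 ^ (n + 2) := by
  rw [contDiff_one_iff_deriv]
  refine ⟨fun t => (hasDerivAt_max_zero_pow n t).differentiableAt, ?_⟩
  have : deriv (fun t : ℝ => max t 0 ^ (n + 2)) = fun t => ((n : ℝ) + 2) * max t 0 ^ (n + 1) :=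
    funext fun t => (hasDerivAt_max_zero_pow n t).deriv
  rw [this]
  fun_prop

/-- The radial weight `(1 - |z|²)₊ⁿ`. -/
def radial (n : ℕ) (z : E3) : ℝ := max (1 - ‖z‖ ^ 2) 0 ^ n

lemma contDiff_radial (n : ℕ) : ContDiff ℝ 1 (radial (n + 2)) :=
  (contDiff_max_zero_pow n).comp (contDiff_const.sub (contDiff_norm_sq ℝ))

lemma continuous_radial (n : ℕ) : Continuous (radial n) := by
  unfold radial; fun_prop

lemma radial_nonneg (n : ℕ) (z : E3) : 0 ≤ radial n z := pow_nonneg (le_max_right _ _) _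

lemma radial_le_one (n : ℕ) (z : E3) : radial n z ≤ 1 :=
  pow_le_one₀ (le_max_right _ _) (max_le (by nlinarith [sq_nonneg ‖z‖]) zero_le_one)

lemma radial_eq_zero {n : ℕ} (hn : n ≠ 0) {z : E3} (hz : z ∉ Metric.ball (0 : E3) 1) :
    radial n z = 0 := by
  have : 1 ≤ ‖z‖ := by simpa using hz
  rw [radial, max_eq_right (by nlinarith), zero_pow hn]

lemma hasCompactSupport_radial {n : ℕ} (hn : n ≠ 0) : HasCompactSupport (radial n) :=
  HasCompactSupport.intro (isCompact_closedBall (0 : E3) 1) fun _ hz =>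
    radial_eq_zero hn fun h => hz (Metric.ball_subset_closedBall h)

/-- Differentiating lowers the exponent by one and produces a factor z. Thus z times a weight is
again a gradient, which drives all the cancellations below. -/
lemma pd_radial (n : ℕ) (j : Fin 3) (z : E3) :
    pd j (radial (n + 2)) z = -(2 * (n + 2)) * (z j * radial (n + 1) z) := by
  have h1 : HasFDerivAt (fun z : E3 => 1 - ‖z‖ ^ 2) (-(2 • (innerSL ℝ z))) z :=
    (hasStrictFDerivAt_norm_sq z).hasFDerivAt.const_sub 1
  have h2 := (hasDerivAt_max_zero_pow n (1 - ‖z‖ ^ 2)).comp_hasFDerivAt z h1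
  rw [HasFDerivAt.pd_eq (f := radial (n + 2)) h2]
  simp [radial, EuclideanSpace.inner_single_right]
  ring

/-- The mass of the averaging weight. -/
def mass : ℝ := ∫ z, radial 3 z

lemma integrable_radial {n : ℕ} (hn : n ≠ 0) : Integrable (radial n) :=
  (continuous_radial n).integrable_of_hasCompactSupport (hasCompactSupport_radial hn)

lemma mass_pos : 0 < mass :=
  (continuous_radial 3).integral_pos_of_hasCompactSupport_nonneg_nonzero
    (hasCompactSupport_radial three_ne_zero) (radial_nonneg 3) (x := 0) (by simp [radial])

/-- Divergence-free fields are orthogonal to radial fields. -/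
lemma integral_radial_mul_divFree {w : Fin 3 → E3 → ℝ} (hw : ∀ j, ContDiff ℝ 1 (w j))
    (hdiv : ∀ x, ∑ j, pd j (w j) x = 0) (x : E3) (s : ℝ) :
    ∫ z, radial 3 z * ∑ j, z j * w j (x + s • z) = 0 := by
  -- The test function is the weight of exponent 4, whose gradient is -8 z times the weight of
  -- exponent 3.
  have h := integral_mul_div (contDiff_radial 2) (hasCompactSupport_radial (by norm_num)) hw x s
  simp only [hdiv, mul_zero, integral_zero, pd_radial 2] at h
  have h2 : ∀ z : E3, ∑ j, -(2 * (((2 : ℕ) : ℝ) + 2)) * (z j * radial (2 + 1) z) * w j (x + s • z)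
      = -8 * (radial 3 z * ∑ j, z j * w j (x + s • z)) := by
    intro z
    rw [Finset.mul_sum, Finset.mul_sum]
    refine Finset.sum_congr rfl fun j _ => ?_
    push_cast; norm_num; ring
  simp_rw [h2] at h
  rw [integral_const_mul] at h
  linarith

/-- A radially weighted average of a field over unit balls at all scales up to `R` is bounded by
its Riesz potential. -/
lemma enorm_integral_average_le {g : E3 → ℝ≥0∞} (hg : Measurable g) (x : E3) {R : ℝ} (hR : 0 ≤ R)
    {I : ℝ → ℝ} {K : ℝ≥0} (hI : ∀ s, ‖I s‖ₑ ≤ K * ∫⁻ z in Metric.ball (0 : E3) 1, g (x + s • z)) :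
    ‖∫ s in (0 : ℝ)..R, I s‖ₑ ≤ K * riesz g x := by
  rw [intervalIntegral.integral_of_le hR]
  refine (enorm_integral_le_lintegral_enorm _).trans ?_
  rw [riesz, ← lintegral_const_mul' _ _ ENNReal.coe_ne_top]
  refine (lintegral_mono_set Set.Ioc_subset_Ioi_self).trans ?_
  refine setLIntegral_mono' measurableSet_Ioi fun s hs => ?_
  rw [← lintegral_ball_affine hg x hs]
  exact hI s

lemma enorm_integral_radial_le {F : E3 → ℝ} {n : ℕ} (hn : n ≠ 0) :
    ‖∫ z, radial n z * F z‖ₑ ≤ ∫⁻ z in Metric.ball (0 : E3) 1, ‖F z‖ₑ := by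
  refine (enorm_integral_le_lintegral_enorm _).trans ?_
  rw [← lintegral_indicator Metric.isOpen_ball.measurableSet]
  refine lintegral_mono fun z => ?_
  by_cases hz : z ∈ Metric.ball (0 : E3) 1
  · rw [Set.indicator_of_mem hz, enorm_mul]
    refine mul_le_of_le_one_left' ?_
    rw [Real.enorm_of_nonneg (radial_nonneg n z)]
    simpa using radial_le_one n z
  · simp [hz, radial_eq_zero hn hz]

/-! ### The Biot-Savart estimate -/

lemma partialDeriv_eq_pd {v : E3 → E3} (hv : ContDiff ℝ 1 v) (j i : Fin 3) (x : E3) :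
    partialDeriv v j i x = pd j (fun y => v y i) x := by
  have h := ((EuclideanSpace.proj (𝕜 := ℝ) i : E3 →L[ℝ] ℝ).hasFDerivAt (x := v x)).comp x
    ((hv.differentiable one_ne_zero) x).hasFDerivAt
  rw [HasFDerivAt.pd_eq (f := fun y => v y i) h]
  rfl

lemma contDiff_comp {v : E3 → E3} {n : ℕ∞ω} (hv : ContDiff ℝ n v) (i : Fin 3) :
    ContDiff ℝ n fun y => v y i :=
  (EuclideanSpace.proj (𝕜 := ℝ) i : E3 →L[ℝ] ℝ).contDiff.comp hv

lemma contDiff_of_comp {v : E3 → E3} {n : ℕ∞ω} (hv : ∀ i, ContDiff ℝ n fun y => v y i) :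
    ContDiff ℝ n v := contDiff_euclidean.2 hv

lemma curl_apply {v : E3 → E3} (hv : ContDiff ℝ 1 v) (x : E3) :
    curl v x 0 = pd 1 (fun y => v y 2) x - pd 2 (fun y => v y 1) x ∧
    curl v x 1 = pd 2 (fun y => v y 0) x - pd 0 (fun y => v y 2) x ∧
    curl v x 2 = pd 0 (fun y => v y 1) x - pd 1 (fun y => v y 0) x := by
  simp [curl, partialDeriv_eq_pd hv]

lemma contDiff_curl {v : E3 → E3} (hv : ContDiff ℝ ∞ v) : ContDiff ℝ ∞ (curl v) := by
  have hv1 : ContDiff ℝ 1 v := hv.of_le (by simp)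
  refine contDiff_of_comp fun i => ?_
  have h := fun j i => contDiff_pd (contDiff_comp hv i) j
  have h0 : (fun y => curl v y 0) = _ := funext fun x => (curl_apply hv1 x).1
  have h1 : (fun y => curl v y 1) = _ := funext fun x => (curl_apply hv1 x).2.1
  have h2 : (fun y => curl v y 2) = _ := funext fun x => (curl_apply hv1 x).2.2
  fin_cases i
  · exact h0 ▸ (h 1 2).sub (h 2 1)
  · exact h1 ▸ (h 2 0).sub (h 0 2)
  · exact h2 ▸ (h 0 1).sub (h 1 0)

lemma abs_pd_sub_pd_le {v : E3 → E3} (hv : ContDiff ℝ 1 v) (i j : Fin 3) (x : E3) :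
    |pd j (fun y => v y i) x - pd i (fun y => v y j) x| ≤ ‖curl v x‖ := by
  have h := fun k => PiLp.norm_apply_le (curl v x) k
  obtain ⟨h0, h1, h2⟩ := curl_apply hv x
  have e0 := h 0
  have e1 := h 1
  have e2 := h 2
  rw [h0, Real.norm_eq_abs] at e0
  rw [h1, Real.norm_eq_abs] at e1
  rw [h2, Real.norm_eq_abs] at e2
  fin_cases i <;> fin_cases j <;> simp only [Fin.zero_eta, Fin.mk_one, Fin.reduceFinMk, sub_self,
    abs_zero, norm_nonneg] <;> first | assumption | (rw [abs_sub_comm]; assumption)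

lemma exists_bound_of_vanishesAtInfinity {v : E3 → E3} (hv : Continuous v)
    (h : VanishesAtInfinity v) : ∃ B : ℝ, ∀ x, ‖v x‖ ≤ B := by
  obtain ⟨R, hR⟩ := h 1 one_pos
  obtain ⟨B, hB⟩ := (isCompact_closedBall (0 : E3) R).exists_bound_of_continuousOn hv.continuousOn
  refine ⟨max B 1, fun x => ?_⟩
  rcases le_total ‖x‖ R with h1 | h1
  · exact (hB x (by simpa using h1)).trans (le_max_left _ _)
  · exact (hR x h1).le.trans (le_max_right _ _)

/-- For fixed z ≠ 0 the point x + R z leaves every ball as R grows. Boundedness of v and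
integrability of the weight allow dominated convergence. -/
lemma tendsto_radial_average {v : E3 → E3} (hv : Continuous v) (h : VanishesAtInfinity v)
    (x : E3) (i : Fin 3) :
    Tendsto (fun R : ℝ => ∫ z, radial 3 z * v (x + R • z) i) atTop (𝓝 0) := by
  obtain ⟨B, hB⟩ := exists_bound_of_vanishesAtInfinity hv h
  have hvi : Continuous fun y => v y i := (EuclideanSpace.proj (𝕜 := ℝ) i).continuous.comp hv
  have hle : ∀ y, |v y i| ≤ ‖v y‖ := fun y => PiLp.norm_apply_le (v y) i
  have := tendsto_integral_filter_of_dominated_convergence (μ := volume) (l := atTop)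
    (F := fun (R : ℝ) z => radial 3 z * v (x + R • z) i) (f := fun _ => 0)
    (fun z => radial 3 z * B) ?_ ?_ ?_ ?_
  · simpa using this
  · exact Eventually.of_forall fun R => ((continuous_radial 3).mul
      (hvi.comp (by fun_prop : Continuous fun z : E3 => x + R • z))).aestronglyMeasurable
  · refine Eventually.of_forall fun R => ae_of_all _ fun z => ?_
    rw [norm_mul, Real.norm_of_nonneg (radial_nonneg _ _)]
    exact mul_le_mul_of_nonneg_left ((hle _).trans (hB _)) (radial_nonneg _ _)
  · exact (integrable_radial three_ne_zero).mul_const B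
  · have hz : ∀ᵐ z : E3, z ≠ 0 := by simp [ae_iff]
    filter_upwards [hz] with z hz
    rw [← mul_zero (radial 3 z)]
    refine Tendsto.const_mul _ ?_
    rw [Metric.tendsto_atTop]
    intro ε hε
    obtain ⟨r, hr⟩ := h ε hε
    refine ⟨max 0 ((r + ‖x‖) / ‖z‖), fun R hR => ?_⟩
    have hzpos : 0 < ‖z‖ := norm_pos_iff.2 hz
    have h1 : r + ‖x‖ ≤ R * ‖z‖ := by
      rw [← div_le_iff₀ hzpos]; exact (le_max_right _ _).trans hR
    have h2 : r ≤ ‖x + R • z‖ := by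
      have h3 : ‖R • z‖ ≤ ‖x + R • z‖ + ‖x‖ := by
        have := norm_sub_le (x + R • z) x
        simpa using this
      rw [norm_smul, Real.norm_of_nonneg ((le_max_left _ _).trans hR)] at h3
      linarith
    rw [Real.dist_eq, sub_zero]
    exact (hle _).trans_lt (hr _ h2)

/-- The defining averaging identity at scale `R`. -/
lemma mass_mul_eq {f : E3 → ℝ} (hf : ContDiff ℝ 1 f) (x : E3) (R : ℝ) :
    mass * f x = (∫ z, radial 3 z * f (x + R • z)) -
      ∫ s in (0 : ℝ)..R, ∫ z, radial 3 z * ∑ j, z j * pd j f (x + s • z) := by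
  rw [← integral_bump_sub (continuous_radial 3) (hasCompactSupport_radial three_ne_zero) hf
    (e := fun _ => x) (d := fun z => z) continuous_const continuous_id R, integral_mul_const]
  simp [mass]

lemma enorm_sum_coord_mul_le {a : Fin 3 → ℝ} {z : E3} (hz : z ∈ Metric.ball (0 : E3) 1) {b : ℝ≥0∞}
    (ha : ∀ j, ‖a j‖ₑ ≤ b) : ‖∑ j, z j * a j‖ₑ ≤ 3 * b := by
  refine (enorm_sum_le _ _).trans ?_
  have : ∀ j ∈ Finset.univ, ‖z j * a j‖ₑ ≤ b := fun j _ => by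
    rw [enorm_mul]
    refine (mul_le_of_le_one_left' ?_).trans (ha j)
    have h1 : ‖z j‖ ≤ 1 := (PiLp.norm_apply_le z j).trans (le_of_lt (by simpa using hz))
    rw [← ofReal_norm]
    simpa using h1
  refine (Finset.sum_le_sum this).trans ?_
  simp

/-- If the gradient of `f` is `F - W` with `W` divergence free, then `f` minus its average at scale
`R` is bounded by the Riesz potential of `F`. -/
lemma enorm_mass_mul_sub_le {f : E3 → ℝ} (hf : ContDiff ℝ 1 f) {F W : Fin 3 → E3 → ℝ}
    (hF : ∀ j, Continuous (F j)) (hW : ∀ j, ContDiff ℝ 1 (W j))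
    (hdiv : ∀ x, ∑ j, pd j (W j) x = 0) (hgrad : ∀ j x, pd j f x = F j x + W j x)
    {g : E3 → ℝ≥0∞} (hg : Measurable g) (hFg : ∀ j x, ‖F j x‖ₑ ≤ g x) (x : E3) {R : ℝ}
    (hR : 0 ≤ R) :
    ‖(∫ z, radial 3 z * f (x + R • z)) - mass * f x‖ₑ ≤ 3 * riesz g x := by
  rw [mass_mul_eq hf x R, sub_sub_cancel]
  refine enorm_integral_average_le (K := 3) hg x hR fun s => ?_
  have hcoord : ∀ j, Continuous fun z : E3 => z j := fun j =>
    (EuclideanSpace.proj (𝕜 := ℝ) j : E3 →L[ℝ] ℝ).continuous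
  have haff : Continuous fun z : E3 => x + s • z := by fun_prop
  have hint : ∀ {w : Fin 3 → E3 → ℝ}, (∀ j, Continuous (w j)) →
      Integrable fun z => radial 3 z * ∑ j, z j * w j (x + s • z) := fun {w} hw =>
    ((continuous_radial 3).mul (continuous_finsetSum _ fun j _ => (hcoord j).mul
      ((hw j).comp haff))).integrable_of_hasCompactSupport
      (hasCompactSupport_radial three_ne_zero).mul_right
  have h1 : ∫ z, radial 3 z * ∑ j, z j * pd j f (x + s • z)
      = ∫ z, radial 3 z * ∑ j, z j * F j (x + s • z) := by
    simp_rw [hgrad, mul_add, Finset.sum_add_distrib, mul_add]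
    rw [integral_add (hint hF) (hint fun j => (hW j).continuous),
      integral_radial_mul_divFree hW hdiv, add_zero]
  rw [h1]
  refine (enorm_integral_radial_le three_ne_zero).trans ?_
  rw [← lintegral_const_mul' _ _ ENNReal.coe_ne_top]
  exact setLIntegral_mono' Metric.isOpen_ball.measurableSet fun z hz =>
    enorm_sum_coord_mul_le hz fun j => hFg j _

lemma enorm_le_of_comp {a : E3} {b : ℝ≥0∞} (h : ∀ i, ‖a i‖ₑ ≤ b) : ‖a‖ₑ ≤ 3 * b := by
  have h1 : a = ∑ i, a i • EuclideanSpace.single i (1 : ℝ) := by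
    have := (EuclideanSpace.basisFun (Fin 3) ℝ).sum_repr a
    simpa using this.symm
  rw [h1]
  refine (enorm_sum_le _ _).trans ((Finset.sum_le_sum (g := fun _ => b) fun i _ => ?_).trans
    (by simp))
  rw [enorm_smul]
  simpa [← ofReal_norm] using h i

lemma enorm_comp_le (a : E3) (i : Fin 3) : ‖a i‖ₑ ≤ ‖a‖ₑ := by
  rw [← ofReal_norm, ← ofReal_norm]
  exact ENNReal.ofReal_le_ofReal (PiLp.norm_apply_le a i)

/-- The absolute constant in the potential estimates. -/
def potConst : ℝ≥0 := 9 / mass.toNNReal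

/-- The factor 3 on the left is kept in reserve for passing from components to vectors, which
accounts for the 9 in `potConst`. -/
lemma enorm_le_of_mass_mul {t : ℝ} {b : ℝ≥0∞} (h : ‖mass * t‖ₑ ≤ 3 * b) :
    3 * ‖t‖ₑ ≤ potConst * b := by
  have hm : mass.toNNReal ≠ 0 := by simpa using mass_pos
  rw [enorm_mul, Real.enorm_of_nonneg mass_pos.le] at h
  rw [potConst, ENNReal.coe_div hm]
  change ENNReal.ofReal mass * ‖t‖ₑ ≤ 3 * b at h
  have h0 : ENNReal.ofReal mass ≠ 0 := by simpa using mass_pos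
  have h2 : ‖t‖ₑ ≤ 3 * b / ENNReal.ofReal mass := by
    rw [ENNReal.le_div_iff_mul_le (Or.inl h0) (Or.inl ENNReal.ofReal_ne_top), mul_comm]
    exact h
  refine (mul_le_mul_right h2 3).trans (le_of_eq ?_)
  change _ = ((9 : ℝ≥0) : ℝ≥0∞) / ENNReal.ofReal mass * b
  rw [div_eq_mul_inv, div_eq_mul_inv, show ((9 : ℝ≥0) : ℝ≥0∞) = 3 * 3 by norm_num]
  ring

/-- The Biot-Savart estimate. -/
theorem enorm_velocity_le {v : E3 → E3} (hv : ContDiff ℝ ∞ v) (hdiv : ∀ x, div v x = 0)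
    (hvan : VanishesAtInfinity v) (x : E3) :
    ‖v x‖ₑ ≤ potConst * riesz (fun y => ‖curl v y‖ₑ) x := by
  have hv1 : ContDiff ℝ 1 v := hv.of_le (by simp)
  have hu := fun i => contDiff_comp hv i
  have hu1 := fun i => contDiff_comp hv1 i
  have hD1 := fun j i => (contDiff_pd (hu i) j).of_le (m := 1) (by simp)
  have hdiv' : ∀ x, ∑ j, pd j (fun y => v y j) x = 0 := fun x => by
    simpa only [div, partialDeriv_eq_pd hv1] using hdiv x
  have key : ∀ i, ‖mass * v x i‖ₑ ≤ 3 * riesz (fun y => ‖curl v y‖ₑ) x := by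
    intro i
    -- Exchanging the derivatives turns this into ∂ᵢ div v.
    have h1 : ∀ y, ∑ j, pd j (pd i fun y => v y j) y = 0 := by
      intro y
      simp_rw [fun j => pd_comm (hu j) j i]
      have h2 : pd i (fun x => ∑ j, pd j (fun y => v y j) x) y
          = ∑ j, pd i (pd j fun y => v y j) y := by
        simp only [Fin.sum_univ_three]
        rw [pd_add ((hD1 0 0).add (hD1 1 1)) (hD1 2 2), pd_add (hD1 0 0) (hD1 1 1)]
      rw [← h2]
      simp_rw [hdiv']
      exact pd_const 0 i y
    have h2 : ∀ R : ℝ, 0 ≤ R → ‖(∫ z, radial 3 z * v (x + R • z) i) - mass * v x i‖ₑ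
        ≤ 3 * riesz (fun y => ‖curl v y‖ₑ) x := fun R hR =>
      enorm_mass_mul_sub_le (hu1 i)
        -- The remainder F consists of components of ω up to sign, while W, the i-th derivative of
        -- v, is divergence free.
        (F := fun j x => pd j (fun y => v y i) x - pd i (fun y => v y j) x)
        (W := fun j => pd i fun y => v y j)
        (fun j => (hD1 j i).continuous.sub (hD1 i j).continuous) (fun j => hD1 i j) h1
        (fun j x => by ring) (contDiff_curl hv).continuous.measurable.enorm
        (fun j y => by
          rw [← ofReal_norm, ← ofReal_norm]
          exact ENNReal.ofReal_le_ofReal (abs_pd_sub_pd_le hv1 i j y)) x hR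
    have h3 : Tendsto (fun R : ℝ => ‖(∫ z, radial 3 z * v (x + R • z) i) - mass * v x i‖ₑ) atTop
        (𝓝 ‖0 - mass * v x i‖ₑ) :=
      (continuous_enorm.tendsto _).comp
        ((tendsto_radial_average hv.continuous hvan x i).sub_const _)
    rw [zero_sub, enorm_neg] at h3
    exact le_of_tendsto h3 ((eventually_ge_atTop 0).mono h2)
  have h3 : ∀ i, ‖v x i‖ₑ ≤ (potConst * riesz (fun y => ‖curl v y‖ₑ) x) / 3 := fun i => by
    rw [ENNReal.le_div_iff_mul_le (by simp) (by simp), mul_comm]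
    exact enorm_le_of_mass_mul (key i)
  refine (enorm_le_of_comp h3).trans (le_of_eq ?_)
  exact ENNReal.mul_div_cancel (by simp) (by simp)

/-! ### The velocity bound in L^{9/2} by duality -/

lemma lintegral_mul_riesz_comm (f g : E3 → ℝ≥0) (hf : Measurable f) (hg : Measurable g) :
    ∫⁻ x, f x * riesz (fun y => g y) x = ∫⁻ x, g x * riesz (fun y => f y) x := by
  rw [lintegral_mul_riesz f g, lintegral_mul_riesz g f, lintegral_triple_swap]
  · refine lintegral_congr fun y => lintegral_congr fun c => lintegral_congr fun x => ?_
    rw [near_comm, mul_comm (f x : ℝ)]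
  · refine measurable_near.mul (ENNReal.measurable_ofReal.comp ?_)
    have h1 : Measurable fun p : E3 × ℝ × E3 => (f p.1 : ℝ) :=
      hf.coe_nnreal_real.comp measurable_fst
    have h2 : Measurable fun p : E3 × ℝ × E3 => (g p.2.2 : ℝ) :=
      hg.coe_nnreal_real.comp (measurable_snd.comp measurable_snd)
    have h3 : Measurable fun p : E3 × ℝ × E3 => p.2.1 ^ (-3 : ℝ) :=
      (measurable_fst.comp measurable_snd).pow_const _
    exact (h1.mul h2).mul h3

/-- This is the division that closes the duality argument. It is legitimate only for finite I, which
is why integrals are first restricted to balls. -/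
lemma rpow_le_of_le_mul_rpow {I A : ℝ≥0∞} (hI : I ≠ ⊤) (h : I ≤ A * I ^ (7 / 9 : ℝ)) :
    I ^ (2 / 9 : ℝ) ≤ A := by
  rcases eq_or_ne I 0 with rfl | h0
  · simp
  have h1 : I = I ^ (2 / 9 : ℝ) * I ^ (7 / 9 : ℝ) := by
    rw [← ENNReal.rpow_add _ _ h0 hI]; norm_num
  have h2 : I ^ (7 / 9 : ℝ) ≠ 0 := by simp [h0, hI]
  have h3 : I ^ (7 / 9 : ℝ) ≠ ⊤ := ENNReal.rpow_ne_top_of_nonneg (by norm_num) hI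
  rw [h1] at h
  have h4 : (I ^ (2 / 9 : ℝ) * I ^ (7 / 9 : ℝ)) ^ (7 / 9 : ℝ) = I ^ (7 / 9 : ℝ) := by rw [← h1]
  rw [h4] at h
  exact (ENNReal.mul_le_mul_iff_left h2 h3).1 h

/-- The Riesz potential maps `L^{9/5}` to `L^{9/2}`. -/
lemma exists_rpow_le_of_le_riesz : ∃ C : ℝ≥0, ∀ (v w : E3 → E3) (K : ℝ≥0), Continuous v →
    Continuous w → (∀ x, ‖v x‖ₑ ≤ K * riesz (fun y => ‖w y‖ₑ) x) →
    (∫⁻ x, ‖v x‖ₑ ^ (9 / 2 : ℝ)) ^ (2 / 9 : ℝ)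
      ≤ K * C * (∫⁻ x, ‖w x‖ₑ ^ (9 / 5 : ℝ)) ^ (5 / 9 : ℝ) := by
  obtain ⟨C, hC⟩ := exists_lintegral_mul_riesz_le
  refine ⟨C, fun v w K hv hw hle => ?_⟩
  have hvm : Measurable fun x => ‖v x‖ₑ ^ (9 / 2 : ℝ) := (hv.measurable.enorm).pow_const _
  have hlim := ((aecover_ball (μ := (volume : Measure E3)) (x := 0)
    tendsto_natCast_atTop_atTop).lintegral_tendsto_of_nat hvm.aemeasurable)
  have hlim2 := ((ENNReal.continuous_rpow_const (y := (2 / 9 : ℝ))).tendsto _).comp hlim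
  refine le_of_tendsto' hlim2 fun n => ?_
  set S := Metric.ball (0 : E3) (n : ℝ)
  have hS : MeasurableSet S := Metric.isOpen_ball.measurableSet
  -- This is the extremal dual function: on S both f|v| and f^{9/7} equal |v|^{9/2}.
  set f : E3 → ℝ≥0 := S.indicator fun y => ‖v y‖₊ ^ (7 / 2 : ℝ) with hf
  have hfm : Measurable f := (hv.measurable.nnnorm.pow_const _).indicator hS
  have hf1 : ∀ y, (f y : ℝ≥0∞) * ‖v y‖ₑ = S.indicator (fun y => ‖v y‖ₑ ^ (9 / 2 : ℝ)) y := by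
    intro y
    by_cases hy : y ∈ S
    · simp only [hf, Set.indicator_of_mem hy]
      rw [ENNReal.coe_rpow_of_nonneg _ (by norm_num), ← enorm_eq_nnnorm]
      nth_rewrite 2 [← ENNReal.rpow_one ‖v y‖ₑ]
      rw [← ENNReal.rpow_add_of_nonneg _ _ (by norm_num) (by norm_num)]
      norm_num
    · simp [hf, hy]
  have hf2 : ∀ y, (f y : ℝ≥0∞) ^ (9 / 7 : ℝ) = S.indicator (fun y => ‖v y‖ₑ ^ (9 / 2 : ℝ)) y := by
    intro y
    by_cases hy : y ∈ S
    · simp only [hf, Set.indicator_of_mem hy]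
      rw [ENNReal.coe_rpow_of_nonneg _ (by norm_num), ← enorm_eq_nnnorm, ← ENNReal.rpow_mul]
      norm_num
    · simp [hf, hy]
  set I := ∫⁻ x in S, ‖v x‖ₑ ^ (9 / 2 : ℝ) with hI
  have hIf : ∫⁻ x, (f x : ℝ≥0∞) ^ (9 / 7 : ℝ) = I := by
    simp_rw [hf2]; rw [lintegral_indicator hS]
  have hItop : I ≠ ⊤ := by
    obtain ⟨B, hB⟩ := (isCompact_closedBall (0 : E3) n).exists_bound_of_continuousOn hv.continuousOn
    refine ne_top_of_le_ne_top (b := ∫⁻ x in S, ENNReal.ofReal B ^ (9 / 2 : ℝ)) ?_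
      (setLIntegral_mono' hS fun x hx => ?_)
    · rw [setLIntegral_const]
      exact ENNReal.mul_ne_top (ENNReal.rpow_ne_top_of_nonneg (by norm_num) ENNReal.ofReal_ne_top)
        measure_ball_lt_top.ne
    · gcongr
      rw [← ofReal_norm]
      exact ENNReal.ofReal_le_ofReal (hB x (Metric.ball_subset_closedBall hx))
  refine rpow_le_of_le_mul_rpow hItop ?_
  calc I = ∫⁻ x, (f x : ℝ≥0∞) * ‖v x‖ₑ := by simp_rw [hf1]; rw [lintegral_indicator hS]
    _ ≤ ∫⁻ x, K * (f x * riesz (fun y => ‖w y‖ₑ) x) := lintegral_mono fun x => by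
        rw [mul_left_comm]; gcongr; exact hle x
    _ = K * ∫⁻ x, f x * riesz (fun y => (‖w y‖₊ : ℝ≥0∞)) x :=
        lintegral_const_mul' _ _ ENNReal.coe_ne_top
    _ = K * ∫⁻ x, (‖w x‖₊ : ℝ≥0∞) * riesz (fun y => f y) x := by
        rw [lintegral_mul_riesz_comm f _ hfm hw.measurable.nnnorm]
    _ ≤ K * (C * (∫⁻ x, ‖w x‖ₑ ^ (9 / 5 : ℝ)) ^ (5 / 9 : ℝ) * I ^ (7 / 9 : ℝ)) := by
        gcongr
        rw [← hIf]
        exact hC _ f hw.measurable.nnnorm hfm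
    _ = _ := by ring

/-! ### Absolute integrability of Φ -/

lemma norm_cross_le (a b : E3) : ‖cross a b‖ ≤ ‖a‖ * ‖b‖ := by
  rw [cross, InnerProductGeometry.norm_ofLp_crossProduct]
  exact mul_le_of_le_one_right (by positivity) (Real.sin_le_one _)

lemma continuous_cross : Continuous fun p : E3 × E3 => cross p.1 p.2 := by
  unfold cross
  simp only [cross_apply]
  refine (PiLp.continuous_toLp 2 _).comp ?_
  refine continuous_pi fun i => ?_
  have h1 : ∀ i, Continuous fun p : E3 × E3 => p.1 i := fun i =>
    (EuclideanSpace.proj (𝕜 := ℝ) i : E3 →L[ℝ] ℝ).continuous.comp continuous_fst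
  have h2 : ∀ i, Continuous fun p : E3 × E3 => p.2 i := fun i =>
    (EuclideanSpace.proj (𝕜 := ℝ) i : E3 →L[ℝ] ℝ).continuous.comp continuous_snd
  fin_cases i
  · exact ((h1 1).mul (h2 2)).sub ((h1 2).mul (h2 1))
  · exact ((h1 2).mul (h2 0)).sub ((h1 0).mul (h2 2))
  · exact ((h1 0).mul (h2 1)).sub ((h1 1).mul (h2 0))

lemma enorm_cross_le (a b : E3) : ‖cross a b‖ₑ ≤ ‖a‖ₑ * ‖b‖ₑ := by
  rw [← ofReal_norm, ← ofReal_norm, ← ofReal_norm, ← ENNReal.ofReal_mul (norm_nonneg _)]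
  exact ENNReal.ofReal_le_ofReal (norm_cross_le a b)

/-- Hölder's inequality with 7/9 = 2/9 + 5/9, applied to the powers 9/7 with conjugate exponents 7/2
and 7/5. -/
lemma rpow_mul_enorm_le {v w : E3 → E3} (hv : Continuous v) (hw : Continuous w) :
    (∫⁻ x, (‖v x‖ₑ * ‖w x‖ₑ) ^ (9 / 7 : ℝ)) ^ (7 / 9 : ℝ) ≤
      (∫⁻ x, ‖v x‖ₑ ^ (9 / 2 : ℝ)) ^ (2 / 9 : ℝ) * (∫⁻ x, ‖w x‖ₑ ^ (9 / 5 : ℝ)) ^ (5 / 9 : ℝ) := by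
  have h := ENNReal.lintegral_mul_le_Lp_mul_Lq (volume : Measure E3) (p := 7 / 2) (q := 7 / 5)
    (Real.holderConjugate_iff.2 (by norm_num)) (f := fun x => ‖v x‖ₑ ^ (9 / 7 : ℝ))
    (g := fun x => ‖w x‖ₑ ^ (9 / 7 : ℝ)) (hv.measurable.enorm.pow_const _).aemeasurable
    (hw.measurable.enorm.pow_const _).aemeasurable
  simp_rw [← ENNReal.rpow_mul] at h
  norm_num at h
  simp_rw [fun x => ENNReal.mul_rpow_of_nonneg ‖v x‖ₑ ‖w x‖ₑ (z := (9 / 7 : ℝ)) (by norm_num)]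
  refine (ENNReal.rpow_le_rpow h (by norm_num)).trans (le_of_eq ?_)
  rw [ENNReal.mul_rpow_of_nonneg _ _ (by norm_num), ← ENNReal.rpow_mul, ← ENNReal.rpow_mul]
  norm_num

lemma rpow_cross_le {v w : E3 → E3} (hv : Continuous v) (hw : Continuous w) :
    (∫⁻ x, ‖cross (v x) (w x)‖ₑ ^ (9 / 7 : ℝ)) ^ (7 / 9 : ℝ) ≤
      (∫⁻ x, ‖v x‖ₑ ^ (9 / 2 : ℝ)) ^ (2 / 9 : ℝ) * (∫⁻ x, ‖w x‖ₑ ^ (9 / 5 : ℝ)) ^ (5 / 9 : ℝ) := by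
  refine le_trans ?_ (rpow_mul_enorm_le hv hw)
  gcongr
  exact enorm_cross_le _ _

lemma riesz_eq_lintegral {g : E3 → ℝ≥0∞} (hg : Measurable g) (x : E3) :
    riesz g x =
      ∫⁻ y, (∫⁻ c in Set.Ioi (0 : ℝ), ENNReal.ofReal (c ^ (-3 : ℝ)) * near c x y) * g y := by
  have hm1 : Measurable fun p : ℝ × E3 => near p.1 x p.2 := by
    unfold near
    exact Measurable.ite (measurableSet_lt (by fun_prop) (by fun_prop)) measurable_const
      measurable_const
  have hm2 : Measurable fun p : ℝ × E3 => p.1 ^ (-3 : ℝ) := measurable_fst.pow_const _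
  have hm : Measurable fun p : ℝ × E3 => ENNReal.ofReal (p.1 ^ (-3 : ℝ)) * near p.1 x p.2 :=
    hm2.ennreal_ofReal.mul hm1
  have h1 : ∀ y, (∫⁻ c in Set.Ioi (0 : ℝ), ENNReal.ofReal (c ^ (-3 : ℝ)) * near c x y) * g y
      = ∫⁻ c in Set.Ioi (0 : ℝ), ENNReal.ofReal (c ^ (-3 : ℝ)) * near c x y * g y := by
    intro y
    have hmy : Measurable fun c : ℝ => ENNReal.ofReal (c ^ (-3 : ℝ)) * near c x y :=
      hm.of_uncurry_right (f := fun c y => ENNReal.ofReal (c ^ (-3 : ℝ)) * near c x y)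
    rw [lintegral_mul_const _ hmy]
  simp_rw [h1]
  rw [lintegral_lintegral_swap]
  · refine lintegral_congr fun c => ?_
    rw [lintegral_ball_eq_near, ← lintegral_const_mul' _ _ ENNReal.ofReal_ne_top]
    simp_rw [mul_assoc]
  · have hms : Measurable fun p : E3 × ℝ => ENNReal.ofReal (p.2 ^ (-3 : ℝ)) * near p.2 x p.1 :=
      hm.comp (measurable_snd.prodMk measurable_fst)
    exact (hms.mul (hg.comp measurable_fst)).aemeasurable

lemma two_mul_ofReal (a : ℝ) : 2 * ENNReal.ofReal a = ENNReal.ofReal (2 * a) := by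
  rw [ENNReal.ofReal_mul zero_le_two, ENNReal.ofReal_ofNat]

/-- The kernel is the integral of c^{-3} over c > |x-y|, that is 1/(2|x-y|²); this identifies
`riesz` with the usual potential of order one. -/
lemma ofReal_inv_sq_le {x y : E3} (h : x ≠ y) :
    ENNReal.ofReal (1 / ‖x - y‖ ^ 2) ≤
      2 * ∫⁻ c in Set.Ioi (0 : ℝ), ENNReal.ofReal (c ^ (-3 : ℝ)) * near c x y := by
  have hr : 0 < ‖x - y‖ := norm_pos_iff.2 (sub_ne_zero.2 h)
  have h1 : ∫⁻ c in Set.Ioi ‖x - y‖, ENNReal.ofReal (c ^ (-3 : ℝ))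
      ≤ ∫⁻ c in Set.Ioi (0 : ℝ), ENNReal.ofReal (c ^ (-3 : ℝ)) * near c x y := by
    rw [← lintegral_indicator measurableSet_Ioi, ← lintegral_indicator measurableSet_Ioi]
    refine lintegral_mono fun c => ?_
    by_cases hc : ‖x - y‖ < c
    · have hc0 : 0 < c := hr.trans hc
      rw [Set.indicator_of_mem (Set.mem_Ioi.2 hc), Set.indicator_of_mem (Set.mem_Ioi.2 hc0)]
      simp [near, dist_eq_norm, hc]
    · simp [hc]
  rw [← ofReal_integral_eq_lintegral_ofReal (integrableOn_Ioi_rpow_of_lt (by norm_num) hr),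
    integral_Ioi_rpow_of_lt (by norm_num) hr] at h1
  · refine le_trans (le_of_eq ?_) (mul_le_mul_right h1 2)
    rw [two_mul_ofReal]
    congr 1
    rw [show (-3 + 1 : ℝ) = -(2 : ℕ) by norm_num, Real.rpow_neg hr.le, Real.rpow_natCast]
    push_cast
    field_simp
  · filter_upwards [ae_restrict_mem measurableSet_Ioi] with c hc
    have : 0 < c := hr.trans hc
    simp only [Pi.zero_apply]; positivity

/-- The two cross products cost one factor |x-y|, leaving |x-y|⁻². The factor 2 from the kernel is
absorbed by 1/(4π) ≤ 1/2. -/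
lemma enorm_Phi_le (v : E3 → E3) (x y : E3) :
    ‖Phi v x y‖ₑ ≤ ‖curl v x‖ₑ *
      ((∫⁻ c in Set.Ioi (0 : ℝ), ENNReal.ofReal (c ^ (-3 : ℝ)) * near c x y)
        * ‖cross (v y) (curl v y)‖ₑ) := by
  rcases eq_or_ne x y with rfl | h
  · simp [Phi]
  set F := cross (v y) (curl v y)
  have hr : 0 < ‖x - y‖ := norm_pos_iff.2 (sub_ne_zero.2 h)
  have h1 : |Phi v x y| ≤ (1 / 2) * (‖curl v x‖ * (1 / ‖x - y‖ ^ 2 * ‖F‖)) := by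
    have h2 : |inner ℝ (curl v x) (cross (x - y) F)| ≤ ‖curl v x‖ * (‖x - y‖ * ‖F‖) :=
      (abs_real_inner_le_norm _ _).trans (by gcongr; exact norm_cross_le _ _)
    have hpi : 1 / (4 * Real.pi) ≤ 1 / 2 := by
      apply one_div_le_one_div_of_le (by norm_num); linarith [Real.pi_gt_three]
    rw [Phi, abs_mul, abs_of_pos (by positivity : 0 < 1 / (4 * Real.pi)), abs_div,
      abs_of_pos (by positivity : 0 < ‖x - y‖ ^ 3)]
    refine mul_le_mul hpi ?_ (by positivity) (by norm_num)
    rw [div_le_iff₀ (by positivity)]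
    refine h2.trans (le_of_eq ?_)
    field_simp
  rw [← ofReal_norm, Real.norm_eq_abs]
  refine (ENNReal.ofReal_le_ofReal h1).trans ?_
  rw [ENNReal.ofReal_mul (by norm_num), ENNReal.ofReal_mul (by positivity),
    ENNReal.ofReal_mul (by positivity), ofReal_norm, ofReal_norm]
  calc ENNReal.ofReal (1 / 2) * (‖curl v x‖ₑ * (ENNReal.ofReal (1 / ‖x - y‖ ^ 2) * ‖F‖ₑ))
      ≤ ENNReal.ofReal (1 / 2) * (‖curl v x‖ₑ * ((2 * ∫⁻ c in Set.Ioi (0 : ℝ),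
        ENNReal.ofReal (c ^ (-3 : ℝ)) * near c x y) * ‖F‖ₑ)) := by
        gcongr; exact ofReal_inv_sq_le h
    _ = (ENNReal.ofReal (1 / 2) * 2) * (‖curl v x‖ₑ * ((∫⁻ c in Set.Ioi (0 : ℝ),
        ENNReal.ofReal (c ^ (-3 : ℝ)) * near c x y) * ‖F‖ₑ)) := by ring
    _ = _ := by
        rw [mul_comm (ENNReal.ofReal _), two_mul_ofReal]
        norm_num

lemma measurable_Phi {v : E3 → E3} (hv : Continuous v) (hw : Continuous (curl v)) :
    Measurable fun z : E3 × E3 => Phi v z.1 z.2 := by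
  unfold Phi
  refine Measurable.const_mul (Measurable.div ?_ ?_) _
  · refine Continuous.measurable ?_
    refine (hw.comp continuous_fst).inner (continuous_cross.comp
      ((continuous_fst.sub continuous_snd).prodMk (continuous_cross.comp
        ((hv.comp continuous_snd).prodMk (hw.comp continuous_snd)))))
  · fun_prop

lemma eLpNorm_eq {w : E3 → E3} {p : ℝ≥0∞} {a b : ℝ} (hp : p.toReal = a) (ha : 0 < a)
    (hb : b = 1 / a) : eLpNorm w p volume = (∫⁻ x, ‖w x‖ₑ ^ a) ^ b := by
  rw [eLpNorm_eq_lintegral_rpow_enorm_toReal, hp, hb]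
  · rintro rfl; simp at hp; linarith
  · rintro rfl; simp at hp; linarith

lemma eLpNorm_nine_fifths (w : E3 → E3) :
    eLpNorm w (9 / 5) volume = (∫⁻ x, ‖w x‖ₑ ^ (9 / 5 : ℝ)) ^ (5 / 9 : ℝ) :=
  eLpNorm_eq (by simp) (by norm_num) (by norm_num)

lemma eLpNorm_nine_halves (w : E3 → E3) :
    eLpNorm w (9 / 2) volume = (∫⁻ x, ‖w x‖ₑ ^ (9 / 2 : ℝ)) ^ (2 / 9 : ℝ) :=
  eLpNorm_eq (by simp) (by norm_num) (by norm_num)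

/-- The exponents close up: ω lies in L^{9/5}, v in L^{9/2}, hence v × ω in L^{9/7}, and (9/5, 9/7)
is an admissible pair for the potential. The constant is a sum so that it dominates the constants of
both estimates. -/
theorem exists_potential_bounds : ∃ C : ℝ≥0, ∀ v : E3 → E3,
      ContDiff ℝ ∞ v →
      (∀ x, div v x = 0) →
      VanishesAtInfinity v →
      MemLp (curl v) (9 / 5) volume →
      eLpNorm v (9 / 2) volume ≤ C * eLpNorm (curl v) (9 / 5) volume ∧
      Integrable (fun z : E3 × E3 => Phi v z.1 z.2) (volume.prod volume) ∧
      ∫⁻ x, ∫⁻ y, ‖Phi v x y‖ₑ ≤ C * eLpNorm (curl v) (9 / 5) volume ^ 3 := by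
  obtain ⟨C₁, h₁⟩ := exists_lintegral_mul_riesz_le
  obtain ⟨C₂, h₂⟩ := exists_rpow_le_of_le_riesz
  refine ⟨potConst * C₂ + C₁ * (potConst * C₂), fun v hv hdiv hvan hL => ?_⟩
  have hvc := hv.continuous
  have hwc := (contDiff_curl hv).continuous
  have hv92 := h₂ v (curl v) potConst hvc hwc (enorm_velocity_le hv hdiv hvan)
  have hFc : Continuous fun y => cross (v y) (curl v y) := continuous_cross.comp (hvc.prodMk hwc)
  have hΦ : ∫⁻ x, ∫⁻ y, ‖Phi v x y‖ₑ ≤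
      (potConst * C₂ + C₁ * (potConst * C₂) : ℝ≥0) * eLpNorm (curl v) (9 / 5) volume ^ 3 := by
    calc ∫⁻ x, ∫⁻ y, ‖Phi v x y‖ₑ
        ≤ ∫⁻ x, ‖curl v x‖ₑ * riesz (fun y => ‖cross (v y) (curl v y)‖ₑ) x := by
          refine lintegral_mono fun x => ?_
          rw [riesz_eq_lintegral hFc.measurable.enorm, ← lintegral_const_mul' _ _ enorm_ne_top]
          exact lintegral_mono fun y => enorm_Phi_le v x y
      _ ≤ C₁ * (∫⁻ x, ‖curl v x‖ₑ ^ (9 / 5 : ℝ)) ^ (5 / 9 : ℝ)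
          * (∫⁻ x, ‖cross (v x) (curl v x)‖ₑ ^ (9 / 7 : ℝ)) ^ (7 / 9 : ℝ) :=
          h₁ (fun x => ‖curl v x‖₊) (fun y => ‖cross (v y) (curl v y)‖₊) hwc.measurable.nnnorm
            hFc.measurable.nnnorm
      _ ≤ C₁ * (∫⁻ x, ‖curl v x‖ₑ ^ (9 / 5 : ℝ)) ^ (5 / 9 : ℝ)
          * ((potConst * C₂ * (∫⁻ x, ‖curl v x‖ₑ ^ (9 / 5 : ℝ)) ^ (5 / 9 : ℝ))
            * (∫⁻ x, ‖curl v x‖ₑ ^ (9 / 5 : ℝ)) ^ (5 / 9 : ℝ)) := by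
          gcongr
          exact (rpow_cross_le hvc hwc).trans (by gcongr)
      _ = (C₁ * (potConst * C₂)) * eLpNorm (curl v) (9 / 5) volume ^ 3 := by
          rw [eLpNorm_nine_fifths]; ring
      _ ≤ _ := by
          push_cast
          gcongr
          exact le_add_self
  refine ⟨?_, ⟨(measurable_Phi hvc hwc).aestronglyMeasurable, ?_⟩, hΦ⟩
  · rw [eLpNorm_nine_halves, eLpNorm_nine_fifths]
    refine hv92.trans ?_
    push_cast
    gcongr
    exact le_self_add
  · rw [HasFiniteIntegral, lintegral_prod _ (measurable_Phi hvc hwc).enorm.aemeasurable]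
    exact hΦ.trans_lt (ENNReal.mul_lt_top ENNReal.coe_lt_top
      (ENNReal.pow_lt_top hL.eLpNorm_lt_top))

/-! ### Rotational form of the equations and the energy identity -/

/-- The antisymmetric part `∂ᵢ vⱼ - ∂ⱼ vᵢ` of the gradient. -/
def vort (v : E3 → E3) (i j : Fin 3) (x : E3) : ℝ :=
  pd i (fun y => v y j) x - pd j (fun y => v y i) x

lemma contDiff_vort {v : E3 → E3} (hv : ContDiff ℝ ∞ v) (i j : Fin 3) :
    ContDiff ℝ ∞ (vort v i j) :=
  (contDiff_pd (contDiff_comp hv j) i).sub (contDiff_pd (contDiff_comp hv i) j)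

lemma enorm_vort_le {v : E3 → E3} (hv : ContDiff ℝ 1 v) (i j : Fin 3) (x : E3) :
    ‖vort v i j x‖ₑ ≤ ‖curl v x‖ₑ := by
  rw [← ofReal_norm, ← ofReal_norm]
  exact ENNReal.ofReal_le_ofReal (abs_pd_sub_pd_le hv j i x)

/-- By antisymmetry of `vort`, contracting it with ∇v gives half the sum of its squares, in which
each component of ω is counted twice. -/
lemma norm_curl_sq {v : E3 → E3} (hv : ContDiff ℝ 1 v) (x : E3) :
    ‖curl v x‖ ^ 2 = ∑ i, ∑ j, pd i (fun y => v y j) x * vort v i j x := by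
  obtain ⟨h0, h1, h2⟩ := curl_apply hv x
  simp only [EuclideanSpace.norm_sq_eq, Fin.sum_univ_three, h0, h1, h2, Real.norm_eq_abs, sq_abs,
    vort]
  ring

/-- The convection term in rotational form. -/
def lamb (v : E3 → E3) (i : Fin 3) (x : E3) : ℝ := ∑ j, v x j * vort v i j x

lemma contDiff_lamb {v : E3 → E3} (hv : ContDiff ℝ ∞ v) (i : Fin 3) :
    ContDiff ℝ ∞ (lamb v i) :=
  ContDiff.sum fun j _ => (contDiff_comp hv j).mul (contDiff_vort hv i j)

lemma enorm_lamb_le {v : E3 → E3} (hv : ContDiff ℝ 1 v) (i : Fin 3) (x : E3) :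
    ‖lamb v i x‖ₑ ≤ 3 * (‖v x‖ₑ * ‖curl v x‖ₑ) := by
  refine (enorm_sum_le _ _).trans ((Finset.sum_le_sum (g := fun _ => ‖v x‖ₑ * ‖curl v x‖ₑ)
    fun j _ => ?_).trans (by simp))
  rw [enorm_mul]
  gcongr
  · exact enorm_comp_le _ _
  · exact enorm_vort_le hv i j x

/-- `H` is a total head of `v`: its gradient is `v × ω - curl ω`. -/
def IsHead (v : E3 → E3) (H : E3 → ℝ) : Prop :=
  ∀ i x, pd i H x = lamb v i x - ∑ j, pd j (vort v i j) x

lemma laplacian_apply {v : E3 → E3} (hv : ContDiff ℝ ∞ v) (i : Fin 3) (x : E3) :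
    Laplacian.laplacian v x i = ∑ j, pd j (pd j fun y => v y i) x := by
  have h := (hv.contDiffAt (x := x)).of_le (m := 2) (WithTop.coe_le_coe.2 le_top)
    |>.laplacian_CLM_comp_left (l := (EuclideanSpace.proj (𝕜 := ℝ) i : E3 →L[ℝ] ℝ))
  change _ = Laplacian.laplacian v x i at h
  rw [← h, InnerProductSpace.laplacian_eq_iteratedFDeriv_orthonormalBasis _
    (EuclideanSpace.basisFun (Fin 3) ℝ)]
  refine Finset.sum_congr rfl fun j _ => ?_
  rw [iteratedFDeriv_two_apply, pd_pd_eq (contDiff_comp hv i)]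
  simp [Function.comp_def]

lemma gradient_apply (p : E3 → ℝ) (x : E3) (i : Fin 3) : gradient p x i = pd i p x := by
  have h := InnerProductSpace.toDual_symm_apply (𝕜 := ℝ) (x := EuclideanSpace.single i (1 : ℝ))
    (y := fderiv ℝ p x)
  rw [pd, ← h, EuclideanSpace.inner_single_right, one_mul]
  rfl

/-- This is curl curl v = ∇ div v - Δv with div v = 0. -/
lemma sum_pd_vort {v : E3 → E3} (hv : ContDiff ℝ ∞ v) (hdiv : ∀ x, div v x = 0) (i : Fin 3)
    (x : E3) : ∑ j, pd j (vort v i j) x = -∑ j, pd j (pd j fun y => v y i) x := by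
  have hv1 : ContDiff ℝ 1 v := hv.of_le (by simp)
  have hu := fun i => contDiff_comp hv i
  have hD1 := fun j i => (contDiff_pd (hu i) j).of_le (m := 1) (by simp)
  have hdiv' : ∀ x, ∑ j, pd j (fun y => v y j) x = 0 := fun x => by
    simpa only [div, partialDeriv_eq_pd hv1] using hdiv x
  have h1 : ∀ j, pd j (vort v i j) x
      = pd i (pd j fun y => v y j) x - pd j (pd j fun y => v y i) x := fun j => by
    rw [← pd_comm (hu j)]
    exact pd_sub (hD1 i j) (hD1 j i) j x
  have h2 : pd i (fun x => ∑ j, pd j (fun y => v y j) x) x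
      = ∑ j, pd i (pd j fun y => v y j) x := by
    simp only [Fin.sum_univ_three]
    rw [pd_add ((hD1 0 0).add (hD1 1 1)) (hD1 2 2), pd_add (hD1 0 0) (hD1 1 1)]
  simp_rw [hdiv'] at h2
  rw [pd_const] at h2
  simp_rw [h1, Finset.sum_sub_distrib, ← h2, zero_sub]

/-- The head is p + |v|²/2, because (v · ∇)v = ∇(|v|²/2) - v × ω and Δv = -curl ω. -/
lemma IsSmoothStationarySolution.exists_isHead {v : E3 → E3} {p : E3 → ℝ}
    (h : IsSmoothStationarySolution v p) : ∃ H, ContDiff ℝ ∞ H ∧ IsHead v H := by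
  have hv := h.smooth_velocity
  have hv1 : ContDiff ℝ 1 v := hv.of_le (by simp)
  have hp1 : ContDiff ℝ 1 p := h.smooth_pressure.of_le (by simp)
  have hu := fun i => contDiff_comp hv i
  have hu1 := fun i => contDiff_comp hv1 i
  have hs := fun i => (hu1 i).mul (hu1 i)
  refine ⟨fun x => p x + 1 / 2 * (v x 0 * v x 0 + v x 1 * v x 1 + v x 2 * v x 2),
    h.smooth_pressure.add (contDiff_const.mul ((((hu 0).mul (hu 0)).add
      ((hu 1).mul (hu 1))).add ((hu 2).mul (hu 2)))), fun i x => ?_⟩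
  rw [pd_add hp1 (contDiff_const.mul (((hs 0).add (hs 1)).add (hs 2))),
    pd_const_mul (((hs 0).add (hs 1)).add (hs 2)), pd_add ((hs 0).add (hs 1)) (hs 2),
    pd_add (hs 0) (hs 1), pd_mul (hu1 0) (hu1 0), pd_mul (hu1 1) (hu1 1), pd_mul (hu1 2) (hu1 2),
    sum_pd_vort hv h.div_free]
  have hm := congrArg (fun a : E3 => a i) (h.momentum x)
  simp only [convection, partialDeriv_eq_pd hv1, PiLp.add_apply, PiLp.neg_apply,
    gradient_apply, laplacian_apply hv] at hm
  simp only [lamb, vort, mul_sub, Finset.sum_sub_distrib, hm]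
  simp only [Fin.sum_univ_three]
  ring

/-- One has div(v × ω) = |ω|² - v · curl ω. Since div v = 0 and v is orthogonal to v × ω, also
div((H - a)v) = v · ∇H = -v · curl ω. The constant a is free and is later chosen so that H - a is
small at infinity. -/
lemma sum_pd_energy {v : E3 → E3} (hv : ContDiff ℝ ∞ v) (hdiv : ∀ x, div v x = 0) {H : E3 → ℝ}
    (hH : ContDiff ℝ ∞ H) (hHv : IsHead v H) (a : ℝ) (x : E3) :
    ∑ j, pd j (fun y => lamb v j y - (H y - a) * v y j) x = ‖curl v x‖ ^ 2 := by
  have hv1 : ContDiff ℝ 1 v := hv.of_le (by simp)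
  have hu1 := fun i => contDiff_comp hv1 i
  have hH1 : ContDiff ℝ 1 H := hH.of_le (by simp)
  have hA1 := fun i j => (contDiff_vort hv i j).of_le (m := 1) (by simp)
  have hdiv' : ∑ j, pd j (fun y => v y j) x = 0 := by
    simpa only [div, partialDeriv_eq_pd hv1] using hdiv x
  have hanti : ∀ i j, pd i (vort v j i) x = - pd i (vort v i j) x := by
    intro i j
    have : vort v j i = fun y => (-1) * vort v i j y := by ext y; simp [vort]
    rw [this, pd_const_mul (hA1 i j)]; ring
  have hl : ∀ i, pd i (lamb v i) x
      = ∑ j, (v x j * pd i (vort v i j) x + vort v i j x * pd i (fun y => v y j) x) := by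
    intro i
    have h3 := fun j => (hu1 j).mul (hA1 i j)
    have : lamb v i = fun y => v y 0 * vort v i 0 y + v y 1 * vort v i 1 y + v y 2 * vort v i 2 y :=
      funext fun y => by simp [lamb, Fin.sum_univ_three]
    rw [this, pd_add ((h3 0).add (h3 1)) (h3 2), pd_add (h3 0) (h3 1)]
    simp only [Fin.sum_univ_three]
    rw [pd_mul (hu1 0) (hA1 i 0), pd_mul (hu1 1) (hA1 i 1), pd_mul (hu1 2) (hA1 i 2)]
  have h4 : ∀ j, pd j (fun y => lamb v j y - (H y - a) * v y j) x
      = pd j (lamb v j) x - ((H x - a) * pd j (fun y => v y j) x + v x j * pd j H x) := by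
    intro j
    rw [pd_sub ((contDiff_lamb hv j).of_le (by simp)) ((hH1.sub contDiff_const).mul (hu1 j)),
      pd_mul (hH1.sub contDiff_const) (hu1 j), pd_sub hH1 contDiff_const, pd_const, sub_zero]
  simp_rw [h4, hl, hHv _ x, norm_curl_sq hv1]
  have hswap : ∀ i j, pd j (vort v i j) x = -pd j (vort v j i) x := fun i j => hanti j i
  simp only [Fin.sum_univ_three] at hdiv' ⊢
  rw [hswap 0 1, hswap 0 2, hswap 1 2, hswap 1 0, hswap 2 0, hswap 2 1]
  have h00 : ∀ i y, vort v i i y = 0 := fun i y => sub_self _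
  have h00' : ∀ i k, pd k (vort v i i) x = 0 := fun i k => by
    rw [show vort v i i = fun _ => 0 from funext (h00 i), pd_const]
  simp only [lamb, Fin.sum_univ_three, h00, h00']
  have e1 : vort v 1 0 x = - vort v 0 1 x := by simp [vort]
  have e2 : vort v 2 0 x = - vort v 0 2 x := by simp [vort]
  have e3 : vort v 2 1 x = - vort v 1 2 x := by simp [vort]
  rw [e1, e2, e3]
  linear_combination (-(H x - a)) * hdiv'

/-! ### Large-scale averages of the head -/

/-- The bound for averages of an `Lᵖ` function at scale `R` given by Hölder's inequality. -/
def avgBound (p : ℝ) (g : E3 → ℝ≥0∞) (R : ℝ) : ℝ≥0∞ :=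
  ENNReal.ofReal (R ^ (-3 / p)) * ((∫⁻ x, g x ^ p) ^ (1 / p)
    * volume (Metric.ball (0 : E3) 1) ^ (1 - 1 / p))

lemma lintegral_ball_le_avgBound {p : ℝ} (hp : 1 < p) {g : E3 → ℝ≥0∞} (hg : Measurable g) (x : E3)
    {R : ℝ} (hR : 0 < R) :
    ∫⁻ z in Metric.ball (0 : E3) 1, g (x + R • z) ≤ avgBound p g R := by
  have hp0 : 0 < p := by linarith
  have hpq := Real.HolderConjugate.conjExponent hp
  have haff : Measurable fun z : E3 => g (x + R • z) := hg.comp (by fun_prop)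
  -- Hölder against the constant 1 on the unit ball; rescaling the L^p norm gives R^{-3/p}.
  have h := ENNReal.lintegral_mul_le_Lp_mul_Lq (volume.restrict (Metric.ball (0 : E3) 1)) hpq
    haff.aemeasurable (aemeasurable_const (b := (1 : ℝ≥0∞)))
  simp only [Pi.mul_apply, mul_one, ENNReal.one_rpow, lintegral_const, one_mul,
    Measure.restrict_apply_univ] at h
  refine h.trans ?_
  have h1 : 1 / p.conjExponent = 1 - 1 / p := by
    have := hpq.inv_add_inv_eq_one
    simp only [one_div]; linarith
  rw [h1, avgBound, ← mul_assoc,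
    lintegral_ball_affine (g := fun y => g y ^ p) (hg.pow_const p) x hR,
    ENNReal.mul_rpow_of_nonneg _ _ (by positivity), ENNReal.ofReal_rpow_of_nonneg
      (by positivity) (by positivity), ← Real.rpow_mul hR.le, mul_one_div]
  gcongr
  exact Measure.restrict_le_self

lemma tendsto_avgBound {p : ℝ} (hp : 1 < p) {g : E3 → ℝ≥0∞} (hg : ∫⁻ x, g x ^ p ≠ ⊤) {q : ℝ}
    (hq : q < 3 / p) :
    Tendsto (fun R : ℝ => ENNReal.ofReal (R ^ q) * avgBound p g R) atTop (𝓝 0) := by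
  have hp0 : 0 < p := by linarith
  have h1 : 0 ≤ 1 - 1 / p := by
    rw [sub_nonneg, div_le_one hp0]; exact hp.le
  have hfin : (∫⁻ x, g x ^ p) ^ (1 / p) * volume (Metric.ball (0 : E3) 1) ^ (1 - 1 / p) ≠ ⊤ :=
    ENNReal.mul_ne_top (ENNReal.rpow_ne_top_of_nonneg (by positivity) hg)
      (ENNReal.rpow_ne_top_of_nonneg h1 measure_ball_lt_top.ne)
  have h2 : Tendsto (fun R : ℝ => ENNReal.ofReal (R ^ (-(3 / p - q)))) atTop (𝓝 0) := by
    rw [← ENNReal.ofReal_zero]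
    exact ENNReal.tendsto_ofReal (tendsto_rpow_neg_atTop (by linarith))
  have h3 := ENNReal.Tendsto.mul_const h2 (Or.inr hfin)
  rw [zero_mul] at h3
  refine h3.congr' ?_
  filter_upwards [eventually_gt_atTop 0] with R hR
  rw [avgBound, ← mul_assoc (ENNReal.ofReal (R ^ q)), ← ENNReal.ofReal_mul (by positivity),
    ← Real.rpow_add hR]
  congr 3
  ring

lemma tendsto_avgBound_zero {p : ℝ} (hp : 1 < p) {g : E3 → ℝ≥0∞} (hg : ∫⁻ x, g x ^ p ≠ ⊤) :
    Tendsto (avgBound p g) atTop (𝓝 0) := by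
  have := tendsto_avgBound hp hg (q := 0) (by positivity)
  simpa using this

/-- The average of the gradient of a total head over a ball of radius `R` is small. -/
lemma enorm_integral_pd_head_le {v : E3 → E3} (hv : ContDiff ℝ ∞ v) {H : E3 → ℝ}
    (hHv : IsHead v H) (i : Fin 3) (p : E3) {R : ℝ} (hR : 4 ≤ R) :
    ‖∫ z, radial 3 z * pd i H (p + R • z)‖ₑ ≤
      (∫⁻ z in Metric.ball (0 : E3) 1, 3 * (‖v (p + R • z)‖ₑ * ‖curl v (p + R • z)‖ₑ)) +
      ∫⁻ z in Metric.ball (0 : E3) 1, 6 * ‖curl v (p + R • z)‖ₑ := by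
  have hv1 : ContDiff ℝ 1 v := hv.of_le (by simp)
  have hA1 := fun j => (contDiff_vort hv i j).of_le (m := 1) (by simp)
  have haff : Continuous fun z : E3 => p + R • z := by fun_prop
  have hc : ∀ {w : E3 → ℝ}, Continuous w → Integrable fun z => radial 3 z * w (p + R • z) :=
    fun hw => ((continuous_radial 3).mul (hw.comp haff)).integrable_of_hasCompactSupport
      (hasCompactSupport_radial three_ne_zero).mul_right
  have hW : Continuous fun x => ∑ j, pd j (vort v i j) x :=
    continuous_finsetSum _ fun j _ => continuous_pd (hA1 j) j
  have hdivR := integral_mul_div (contDiff_radial 1) (hasCompactSupport_radial three_ne_zero)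
    hA1 p R
  have hW2 : ‖∫ z, radial 3 z * ∑ j, pd j (vort v i j) (p + R • z)‖ₑ ≤
      ∫⁻ z in Metric.ball (0 : E3) 1, 6 * ‖curl v (p + R • z)‖ₑ := by
    -- Integration by parts moves the derivative of the vorticity onto the weight, gaining 1/R; the
    -- 6 comes from the exponent 3.
    have h1 : ∫ z, radial 3 z * ∑ j, pd j (vort v i j) (p + R • z)
        = ∫ z, radial 2 z * ((6 / R) * ∑ j, z j * vort v i j (p + R • z)) := by
      have hR0 : R ≠ 0 := by linarith
      apply mul_left_cancel₀ hR0
      rw [hdivR, ← integral_const_mul, ← integral_neg]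
      refine integral_congr_ae (ae_of_all _ fun z => ?_)
      simp only [pd_radial 1, Fin.sum_univ_three]
      norm_num
      field_simp
      ring
    rw [h1]
    refine (enorm_integral_radial_le two_ne_zero).trans ?_
    refine setLIntegral_mono' Metric.isOpen_ball.measurableSet fun z hz => ?_
    rw [enorm_mul]
    have h2 : ‖(6 / R : ℝ)‖ₑ ≤ 2 := by
      rw [Real.enorm_of_nonneg (by positivity), ← ENNReal.ofReal_ofNat (n := 2)]
      apply ENNReal.ofReal_le_ofReal
      rw [div_le_iff₀ (by linarith)]; linarith
    calc _ ≤ 2 * (3 * ‖curl v (p + R • z)‖ₑ) :=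
          mul_le_mul' h2 (enorm_sum_coord_mul_le hz fun j => enorm_vort_le hv1 i j _)
      _ = _ := by rw [← mul_assoc]; norm_num
  have hsplit : ∫ z, radial 3 z * pd i H (p + R • z) = (∫ z, radial 3 z * lamb v i (p + R • z))
      - ∫ z, radial 3 z * ∑ j, pd j (vort v i j) (p + R • z) := by
    rw [← integral_sub (hc (contDiff_lamb hv i).continuous) (hc hW)]
    refine integral_congr_ae (ae_of_all _ fun z => ?_)
    simp only [hHv i]
    ring
  rw [hsplit]
  refine (enorm_sub_le).trans (add_le_add ?_ hW2)
  exact (enorm_integral_radial_le three_ne_zero).trans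
    (lintegral_mono fun z => enorm_lamb_le hv1 i _)

/-- Averages of a total head over large balls are asymptotically independent of the center. -/
lemma tendsto_radial_average_sub {v : E3 → E3} (hv : ContDiff ℝ ∞ v) {H : E3 → ℝ}
    (hH : ContDiff ℝ ∞ H) (hHv : IsHead v H)
    (hw : ∫⁻ x, ‖curl v x‖ₑ ^ (9 / 5 : ℝ) ≠ ⊤)
    (hF : ∫⁻ x, (3 * (‖v x‖ₑ * ‖curl v x‖ₑ)) ^ (9 / 7 : ℝ) ≠ ⊤) (x x' : E3) :
    Tendsto (fun R : ℝ => (∫ z, radial 3 z * H (x + R • z)) - ∫ z, radial 3 z * H (x' + R • z))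
      atTop (𝓝 0) := by
  have hH1 : ContDiff ℝ 1 H := hH.of_le (by simp)
  have hvm := hv.continuous.measurable.enorm
  have hwm := (contDiff_curl hv).continuous.measurable.enorm
  set δ : ℝ → ℝ≥0∞ := fun R => avgBound (9 / 7) (fun x => 3 * (‖v x‖ₑ * ‖curl v x‖ₑ)) R
    + 6 * avgBound (9 / 5) (fun x => ‖curl v x‖ₑ) R with hδ
  have hδ0 : Tendsto δ atTop (𝓝 0) := by
    have h1 := tendsto_avgBound_zero (by norm_num) hF
    have h2 := ENNReal.Tendsto.const_mul (a := 6)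
      (tendsto_avgBound_zero (by norm_num) hw) (Or.inr (by simp))
    simpa using h1.add h2
  have hpd : ∀ i p R, 4 ≤ R → ‖∫ z, radial 3 z * pd i H (p + R • z)‖ₑ ≤ δ R := by
    intro i p R hR
    have hR0 : 0 < R := by linarith
    refine (enorm_integral_pd_head_le hv hHv i p hR).trans (add_le_add ?_ ?_)
    · exact lintegral_ball_le_avgBound (by norm_num)
        (g := fun x => 3 * (‖v x‖ₑ * ‖curl v x‖ₑ)) ((hvm.mul hwm).const_mul 3) p hR0
    · rw [lintegral_const_mul' _ _ (by simp)]
      gcongr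
      exact lintegral_ball_le_avgBound (by norm_num) (g := fun x => ‖curl v x‖ₑ) hwm p hR0
  have hbound : ∀ R : ℝ, 4 ≤ R → ‖(∫ z, radial 3 z * H (x + R • z))
      - ∫ z, radial 3 z * H (x' + R • z)‖ₑ ≤ (3 * ‖x - x'‖ₑ) * δ R := by
    intro R hR
    -- The centre is moved from x' to x along a segment, so the difference of averages is a mean of
    -- averages of ∇H, each bounded by δ R.
    have h1 := integral_bump_sub (continuous_radial 3) (hasCompactSupport_radial three_ne_zero)
      hH1 (e := fun z => x' + R • z) (d := fun _ => x - x') (by fun_prop) continuous_const 1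
    have h2 : ∀ z : E3, x' + R • z + (1 : ℝ) • (x - x') = x + R • z := fun z => by
      rw [one_smul]; abel
    simp_rw [h2] at h1
    rw [h1, intervalIntegral.integral_of_le zero_le_one]
    refine (enorm_integral_le_lintegral_enorm _).trans ?_
    have h3 : ∀ s : ℝ, ‖∫ z, radial 3 z * ∑ j, (x - x') j * pd j H (x' + R • z + s • (x - x'))‖ₑ
        ≤ (3 * ‖x - x'‖ₑ) * δ R := by
      intro s
      have h4 : ∀ z : E3, x' + R • z + s • (x - x') = (x' + s • (x - x')) + R • z := fun z => by
        abel
      simp_rw [h4, Finset.mul_sum]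
      have haff : Continuous fun z : E3 => (x' + s • (x - x')) + R • z := by fun_prop
      have hint : ∀ j, Integrable fun z => radial 3 z *
          ((x - x') j * pd j H ((x' + s • (x - x')) + R • z)) := fun j =>
        ((continuous_radial 3).mul (continuous_const.mul
          ((continuous_pd hH1 j).comp haff))).integrable_of_hasCompactSupport
          (hasCompactSupport_radial three_ne_zero).mul_right
      rw [integral_finsetSum _ fun j _ => hint j]
      refine (enorm_sum_le _ _).trans ((Finset.sum_le_sum (g := fun _ => ‖x - x'‖ₑ * δ R)
        fun j _ => ?_).trans (by simp [mul_assoc]))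
      simp_rw [mul_left_comm (radial 3 _)]
      rw [integral_const_mul, enorm_mul]
      gcongr
      · exact enorm_comp_le _ j
      · exact hpd j _ R hR
    refine (lintegral_mono fun s => h3 s).trans ?_
    simp
  have hlim : Tendsto (fun R => (3 * ‖x - x'‖ₑ) * δ R) atTop (𝓝 0) := by
    have := ENNReal.Tendsto.const_mul (a := 3 * ‖x - x'‖ₑ) hδ0
      (Or.inr (ENNReal.mul_ne_top (by simp) enorm_ne_top))
    simpa using this
  rw [tendsto_zero_iff_enorm_tendsto_zero]
  exact tendsto_of_tendsto_of_tendsto_of_le_of_le' tendsto_const_nhds hlim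
    (Eventually.of_forall fun _ => zero_le) ((eventually_ge_atTop 4).mono hbound)

/-- A total head differs between two points by at most the Riesz potentials of `v × ω` there. -/
lemma enorm_head_sub_le {v : E3 → E3} (hv : ContDiff ℝ ∞ v) {H : E3 → ℝ}
    (hH : ContDiff ℝ ∞ H) (hHv : IsHead v H)
    (hw : ∫⁻ x, ‖curl v x‖ₑ ^ (9 / 5 : ℝ) ≠ ⊤)
    (hF : ∫⁻ x, (3 * (‖v x‖ₑ * ‖curl v x‖ₑ)) ^ (9 / 7 : ℝ) ≠ ⊤) (x x' : E3) :
    ‖mass * (H x - H x')‖ₑ ≤ 3 * (riesz (fun y => 3 * (‖v y‖ₑ * ‖curl v y‖ₑ)) x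
      + riesz (fun y => 3 * (‖v y‖ₑ * ‖curl v y‖ₑ)) x') := by
  have hv1 : ContDiff ℝ 1 v := hv.of_le (by simp)
  have hH1 : ContDiff ℝ 1 H := hH.of_le (by simp)
  have hvm := hv.continuous.measurable.enorm
  have hwm := (contDiff_curl hv).continuous.measurable.enorm
  set g : E3 → ℝ≥0∞ := fun y => 3 * (‖v y‖ₑ * ‖curl v y‖ₑ)
  have hgm : Measurable g := (hvm.mul hwm).const_mul 3
  set W : Fin 3 → E3 → ℝ := fun i x => -∑ j, pd j (vort v i j) x with hW
  have hWc : ∀ i, ContDiff ℝ ∞ (W i) := fun i =>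
    (ContDiff.sum fun j _ => contDiff_pd (contDiff_vort hv i j) j).neg
  -- The symmetric second derivatives are contracted with the antisymmetric `vort`, so the sum
  -- equals its own negative.
  have hWdiv : ∀ x, ∑ i, pd i (W i) x = 0 := by
    intro x
    have hA := fun i j => contDiff_vort hv i j
    have hA1 := fun i j k => (contDiff_pd (hA i j) k).of_le (m := 1) (by simp)
    have h1 : ∀ i, pd i (W i) x = -∑ j, pd i (pd j (vort v i j)) x := by
      intro i
      have h2 : W i = fun y => (-1) * (pd 0 (vort v i 0) y + pd 1 (vort v i 1) y
          + pd 2 (vort v i 2) y) := funext fun y => by simp [hW, Fin.sum_univ_three]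
      rw [h2, pd_const_mul (((hA1 i 0 0).add (hA1 i 1 1)).add (hA1 i 2 2)),
        pd_add ((hA1 i 0 0).add (hA1 i 1 1)) (hA1 i 2 2), pd_add (hA1 i 0 0) (hA1 i 1 1)]
      simp only [Fin.sum_univ_three]
      ring
    have h3 : ∀ i j, pd i (pd j (vort v i j)) x = -pd j (pd i (vort v j i)) x := by
      intro i j
      have h4 : vort v j i = fun y => (-1) * vort v i j y := by ext y; simp [vort]
      have h5 : pd i (vort v j i) = fun y => (-1) * pd i (vort v i j) y := funext fun y => by
        rw [h4, pd_const_mul ((hA i j).of_le (by simp))]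
      rw [h5, pd_const_mul (hA1 i j i), pd_comm (hA i j) i j]
      ring
    simp_rw [h1, Finset.sum_neg_distrib]
    have h6 : ∑ i, ∑ j, pd i (pd j (vort v i j)) x = -∑ i, ∑ j, pd i (pd j (vort v i j)) x := by
      conv_lhs => rw [Finset.sum_comm]
      simp_rw [← Finset.sum_neg_distrib]
      exact Finset.sum_congr rfl fun i _ => Finset.sum_congr rfl fun j _ => h3 j i
    linarith
  have hone : ∀ (x : E3) (R : ℝ), 0 ≤ R →
      ‖(∫ z, radial 3 z * H (x + R • z)) - mass * H x‖ₑ ≤ 3 * riesz g x := fun x R hR =>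
    enorm_mass_mul_sub_le hH1 (F := lamb v) (W := W) (fun j => (contDiff_lamb hv j).continuous)
      (fun j => (hWc j).of_le (by simp)) hWdiv (fun j x => by rw [hHv j x, sub_eq_add_neg]) hgm
      (fun j x => enorm_lamb_le hv1 j x) x hR
  have hlim := tendsto_radial_average_sub hv hH hHv hw hF x x'
  have hlim2 : Tendsto (fun R : ℝ => ‖((∫ z, radial 3 z * H (x + R • z))
      - ∫ z, radial 3 z * H (x' + R • z)) - mass * (H x - H x')‖ₑ) atTop
      (𝓝 ‖0 - mass * (H x - H x')‖ₑ) :=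
    (continuous_enorm.tendsto _).comp (hlim.sub_const _)
  rw [zero_sub, enorm_neg] at hlim2
  refine le_of_tendsto hlim2 ((eventually_ge_atTop 0).mono fun R hR => ?_)
  have h7 : ((∫ z, radial 3 z * H (x + R • z)) - ∫ z, radial 3 z * H (x' + R • z))
      - mass * (H x - H x') = ((∫ z, radial 3 z * H (x + R • z)) - mass * H x)
      - ((∫ z, radial 3 z * H (x' + R • z)) - mass * H x') := by ring
  rw [h7, mul_add]
  exact enorm_sub_le.trans (add_le_add (hone x R hR) (hone x' R hR))

/-! ### The constant value of the head at infinity -/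

/-- The Riesz potential of an `L^{9/7}` function has infimum zero. -/
lemma exists_riesz_le {g : E3 → ℝ≥0} (hg : Measurable g)
    (hfin : ∫⁻ x, (g x : ℝ≥0∞) ^ (9 / 7 : ℝ) ≠ ⊤) {ε : ℝ≥0∞} (hε : ε ≠ 0) :
    ∃ x, riesz (fun y => g y) x ≤ ε := by
  by_contra! hcon
  obtain ⟨C, hC⟩ := exists_lintegral_mul_riesz_le
  set M := C * (∫⁻ x, (g x : ℝ≥0∞) ^ (9 / 7 : ℝ)) ^ (7 / 9 : ℝ)
  have hM : M ≠ ⊤ := ENNReal.mul_ne_top ENNReal.coe_ne_top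
    (ENNReal.rpow_ne_top_of_nonneg (by norm_num) hfin)
  -- If the potential exceeded ε everywhere, testing it against the indicator of a ball S would give
  -- ε|S| ≤ M|S|^{5/9}, which fails for large balls.
  have hle : ∀ n : ℕ, ε * volume (Metric.ball (0 : E3) (n + 1)) ^ (4 / 9 : ℝ) ≤ M := by
    intro n
    set S := Metric.ball (0 : E3) (n + 1)
    have hS : MeasurableSet S := Metric.isOpen_ball.measurableSet
    have hV0 : volume S ≠ 0 := (Metric.measure_ball_pos volume _ (by positivity)).ne'
    have hVt : volume S ≠ ⊤ := measure_ball_lt_top.ne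
    set f : E3 → ℝ≥0 := S.indicator fun _ => 1 with hf
    have h1 := hC f g (measurable_const.indicator hS) hg
    have h2 : ∫⁻ x, (f x : ℝ≥0∞) ^ (9 / 5 : ℝ) = volume S := by
      rw [← lintegral_indicator_one hS]
      refine lintegral_congr fun x => ?_
      by_cases hx : x ∈ S <;> simp [hf, hx]
    have h3 : ε * volume S ≤ ∫⁻ x, f x * riesz (fun y => g y) x := by
      rw [← lintegral_indicator_const hS]
      refine lintegral_mono fun x => ?_
      by_cases hx : x ∈ S
      · simpa [hf, hx] using (hcon x).le
      · simp [hf, hx]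
    rw [h2] at h1
    have h4 : volume S = volume S ^ (4 / 9 : ℝ) * volume S ^ (5 / 9 : ℝ) := by
      rw [← ENNReal.rpow_add _ _ hV0 hVt]; norm_num
    have h5 : ε * volume S ^ (4 / 9 : ℝ) * volume S ^ (5 / 9 : ℝ) ≤ M * volume S ^ (5 / 9 : ℝ) := by
      rw [mul_assoc, ← h4]
      refine (h3.trans h1).trans (le_of_eq ?_)
      ring
    have h6 : volume S ^ (5 / 9 : ℝ) ≠ 0 := by simp [hV0, hVt]
    exact (ENNReal.mul_le_mul_iff_left h6
      (ENNReal.rpow_ne_top_of_nonneg (by norm_num) hVt)).1 h5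
  have hlim : Tendsto (fun n : ℕ => ε * volume (Metric.ball (0 : E3) (n + 1)) ^ (4 / 9 : ℝ)) atTop
      (𝓝 ⊤) := by
    have hκ : volume (Metric.ball (0 : E3) 1) ≠ 0 :=
      (Metric.measure_ball_pos volume _ one_pos).ne'
    have h1 : Tendsto (fun n : ℕ => ((n : ℝ) + 1) ^ 3) atTop atTop :=
      (tendsto_pow_atTop three_ne_zero).comp
        (tendsto_atTop_add_const_right _ _ tendsto_natCast_atTop_atTop)
    have h2 : Tendsto (fun n : ℕ => volume (Metric.ball (0 : E3) (n + 1))) atTop (𝓝 ⊤) := by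
      have := ENNReal.Tendsto.mul_const (ENNReal.tendsto_ofReal_atTop.comp h1)
        (Or.inl ENNReal.top_ne_zero) (b := volume (Metric.ball (0 : E3) 1))
      rw [ENNReal.top_mul hκ] at this
      refine this.congr fun n => ?_
      rw [volume_ball_eq 0 (c := (n : ℝ) + 1) (by positivity)]; rfl
    have h3 := ((ENNReal.continuous_rpow_const (y := (4 / 9 : ℝ))).tendsto _).comp h2
    rw [ENNReal.top_rpow_of_pos (by norm_num)] at h3
    have h4 := ENNReal.Tendsto.const_mul (a := ε) h3 (Or.inl ENNReal.top_ne_zero)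
    rwa [ENNReal.mul_top hε] at h4
  exact hM (top_le_iff.1 (le_of_tendsto' hlim hle))

/-- A function with small oscillation between points of small potential tends to a constant. -/
lemma exists_const_of_enorm_sub_le {h : E3 → ℝ} {G : E3 → ℝ≥0∞}
    (hG : ∀ ε : ℝ≥0∞, ε ≠ 0 → ∃ x, G x ≤ ε) (hle : ∀ x x', ‖h x - h x'‖ₑ ≤ 3 * (G x + G x')) :
    ∃ a, ∀ x, ‖h x - a‖ₑ ≤ 3 * G x := by
  have hex : ∀ n : ℕ, ∃ x, G x ≤ ((n : ℝ≥0∞) + 1)⁻¹ := fun n => hG _ (by simp)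
  choose y hy using hex
  have hlim : Tendsto (fun n : ℕ => ((n : ℝ≥0∞) + 1)⁻¹) atTop (𝓝 0) := by
    have := (tendsto_add_atTop_iff_nat 1).2 ENNReal.tendsto_inv_nat_nhds_zero
    simpa using this
  -- The points y n need not converge or escape; only the smallness of G there is used. The limit of
  -- h along them is the desired constant.
  have hcauchy : CauchySeq fun n => h (y n) := by
    rw [EMetric.cauchySeq_iff_le_tendsto_0]
    refine ⟨fun n => 3 * (((n : ℝ≥0∞) + 1)⁻¹ + ((n : ℝ≥0∞) + 1)⁻¹), fun n m N hn hm => ?_, ?_⟩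
    · rw [edist_eq_enorm_sub]
      refine (hle _ _).trans ?_
      beta_reduce
      gcongr
      · exact (hy n).trans (ENNReal.inv_le_inv.2 (by gcongr))
      · exact (hy m).trans (ENNReal.inv_le_inv.2 (by gcongr))
    · have := ENNReal.Tendsto.const_mul (a := 3) (hlim.add hlim) (Or.inr (by simp))
      simpa using this
  obtain ⟨a, ha⟩ := cauchySeq_tendsto_of_complete hcauchy
  refine ⟨a, fun x => ?_⟩
  have h1 : Tendsto (fun n => ‖h x - h (y n)‖ₑ) atTop (𝓝 ‖h x - a‖ₑ) :=
    (continuous_enorm.tendsto _).comp (ha.const_sub _)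
  have h2 : Tendsto (fun n : ℕ => 3 * (G x + ((n : ℝ≥0∞) + 1)⁻¹)) atTop (𝓝 (3 * (G x + 0))) :=
    ENNReal.Tendsto.const_mul (tendsto_const_nhds.add hlim) (Or.inr (by simp))
  rw [add_zero] at h2
  exact le_of_tendsto_of_tendsto' h1 h2 fun n => (hle x (y n)).trans (by gcongr; exact hy n)

/-! ### Cutoff argument and the Liouville theorem -/

/-- The `L^{9/5}` norm over a shell of radius `R` in terms of the `L^{9/2}` norm. -/
lemma rpow_lintegral_shell_le {v : E3 → E3} (hv : Continuous v) {R : ℝ} (hR : 0 ≤ R) {T : Set E3} :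
    (∫⁻ x in Metric.ball (0 : E3) R ∩ T, ‖v x‖ₑ ^ (9 / 5 : ℝ)) ^ (5 / 9 : ℝ) ≤
      (∫⁻ x in T, ‖v x‖ₑ ^ (9 / 2 : ℝ)) ^ (2 / 9 : ℝ) *
        (ENNReal.ofReal R * volume (Metric.ball (0 : E3) 1) ^ (1 / 3 : ℝ)) := by
  -- Hölder with 5/9 = 2/9 + 1/3; the volume of the ball to the power 1/3 is the source of the
  -- factor R.
  have h := ENNReal.lintegral_mul_le_Lp_mul_Lq (volume.restrict (Metric.ball (0 : E3) R ∩ T))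
    (p := 5 / 2) (q := 5 / 3) (Real.holderConjugate_iff.2 (by norm_num))
    (f := fun x => ‖v x‖ₑ ^ (9 / 5 : ℝ)) (g := fun _ => 1)
    (hv.measurable.enorm.pow_const _).aemeasurable aemeasurable_const
  simp_rw [← ENNReal.rpow_mul] at h
  simp only [Pi.mul_apply, mul_one, ENNReal.one_rpow, lintegral_const, one_mul,
    Measure.restrict_apply_univ] at h
  norm_num at h
  refine (ENNReal.rpow_le_rpow h (by norm_num)).trans ?_
  rw [ENNReal.mul_rpow_of_nonneg _ _ (by norm_num), ← ENNReal.rpow_mul, ← ENNReal.rpow_mul]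
  norm_num
  have h1 : volume (Metric.ball (0 : E3) R ∩ T) ^ (1 / 3 : ℝ)
      ≤ ENNReal.ofReal R * volume (Metric.ball (0 : E3) 1) ^ (1 / 3 : ℝ) := by
    refine (ENNReal.rpow_le_rpow (measure_mono Set.inter_subset_left) (by norm_num)).trans ?_
    rw [volume_ball_eq 0 hR, ENNReal.mul_rpow_of_nonneg _ _ (by norm_num),
      ENNReal.ofReal_pow hR, ← ENNReal.rpow_natCast, ← ENNReal.rpow_mul]
    norm_num
  refine mul_le_mul' ?_ (by simpa using h1)
  gcongr
  exact Set.inter_subset_right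

lemma tendsto_lintegral_compl_ball {f : E3 → ℝ≥0∞} (hf : Measurable f) (hfin : ∫⁻ x, f x ≠ ⊤) :
    Tendsto (fun R : ℝ => ∫⁻ x in (Metric.ball (0 : E3) (R / 2))ᶜ, f x) atTop (𝓝 0) := by
  have hS : ∀ R : ℝ, MeasurableSet (Metric.ball (0 : E3) (R / 2))ᶜ := fun R =>
    Metric.isOpen_ball.measurableSet.compl
  simp_rw [← lintegral_indicator (hS _)]
  rw [← lintegral_zero (μ := (volume : Measure E3))]
  refine tendsto_lintegral_filter_of_dominated_convergence f
    (Eventually.of_forall fun R => hf.indicator (hS R))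
    (Eventually.of_forall fun R => ae_of_all _ fun x => Set.indicator_le_self _ _ _) hfin
    (ae_of_all _ fun x => ?_)
  refine tendsto_const_nhds.congr' ?_
  filter_upwards [eventually_gt_atTop (2 * ‖x‖)] with R hR
  have : x ∈ Metric.ball (0 : E3) (R / 2) := by
    rw [mem_ball_zero_iff]; linarith
  simp [this]

lemma exists_pd_bound {φ : E3 → ℝ} (hφ : ContDiff ℝ 1 φ) (hc : HasCompactSupport φ) :
    ∃ M : ℝ≥0, ∀ j z, ‖pd j φ z‖ₑ ≤ M := by
  have h : ∀ j, ∃ M : ℝ≥0, ∀ z, ‖pd j φ z‖ₑ ≤ M := fun j => by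
    obtain ⟨B, hB⟩ := (continuous_pd hφ j).bounded_above_of_compact_support
      (hc.fderiv_apply (𝕜 := ℝ) _)
    refine ⟨B.toNNReal, fun z => ?_⟩
    rw [← ofReal_norm]
    exact ENNReal.ofReal_le_ofReal (hB z)
  choose M hM using h
  exact ⟨∑ j, M j, fun j z => (hM j z).trans (ENNReal.coe_le_coe.2
    (Finset.single_le_sum (f := M) (fun _ _ => zero_le) (Finset.mem_univ j)))⟩

/-- If `|q|² = div Y`, then the mean of `|q|²` over a ball is controlled by that of `|Y|` over a
surrounding shell. -/
lemma exists_cutoff_bound : ∃ M : ℝ≥0, ∀ (q : E3 → ℝ) (Y : Fin 3 → E3 → ℝ) (b : E3 → ℝ≥0∞),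
    Continuous q → (∀ j, ContDiff ℝ 1 (Y j)) → (∀ x, ∑ j, pd j (Y j) x = q x ^ 2) →
    (∀ j x, ‖Y j x‖ₑ ≤ b x) → ∀ R : ℝ, 0 < R →
    ENNReal.ofReal R * ∫⁻ z in Metric.ball (0 : E3) 1,
        (Metric.ball (0 : E3) (R / 2)).indicator (fun y => ‖q y‖ₑ ^ 2) (0 + R • z) ≤
      M * ∫⁻ z in Metric.ball (0 : E3) 1,
        (Metric.ball (0 : E3) (R / 2))ᶜ.indicator b (0 + R • z) := by
  -- The cutoff is 1 on |z| ≤ 1/2 and supported in |z| ≤ 3/4, so its gradient lives where |R z| ≥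
  -- R/2 and inside the unit ball.
  let φ : ContDiffBump (0 : E3) := ⟨1 / 2, 3 / 4, by norm_num, by norm_num⟩
  have hφ : ContDiff ℝ 1 (φ : E3 → ℝ) := φ.contDiff
  have hφc : HasCompactSupport (φ : E3 → ℝ) := φ.hasCompactSupport
  obtain ⟨M, hM⟩ := exists_pd_bound hφ hφc
  refine ⟨3 * M, fun q Y b hq hY hdiv hb R hR => ?_⟩
  have hmem : ∀ z : E3, (0 + R • z ∈ Metric.ball (0 : E3) (R / 2)) ↔ ‖z‖ < 1 / 2 := by
    intro z
    rw [zero_add, mem_ball_zero_iff, norm_smul, Real.norm_of_nonneg hR.le]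
    constructor <;> intro h <;> nlinarith
  have hpd : ∀ j (z : E3), ‖z‖ < 1 / 2 → pd j φ z = 0 := by
    intro j z hz
    have : (φ : E3 → ℝ) =ᶠ[𝓝 z] fun _ => 1 := by
      have hz' : Metric.ball (0 : E3) (1 / 2) ∈ 𝓝 z :=
        Metric.isOpen_ball.mem_nhds (by simpa using hz)
      filter_upwards [hz'] with w hw
      exact φ.one_of_mem_closedBall (Metric.ball_subset_closedBall hw)
    rw [pd, this.fderiv_eq]; simp
  have hpd' : ∀ j (z : E3), z ∉ Metric.ball (0 : E3) 1 → pd j φ z = 0 := by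
    intro j z hz
    have h1 : tsupport (pd j φ) ⊆ tsupport φ := tsupport_fderiv_apply_subset ℝ _
    rw [φ.tsupport_eq] at h1
    exact image_eq_zero_of_notMem_tsupport fun h => hz
      (Metric.closedBall_subset_ball (by norm_num) (h1 h))
  have h := integral_mul_div hφ hφc hY 0 R
  simp_rw [hdiv] at h
  have hl : ENNReal.ofReal R * ∫⁻ z in Metric.ball (0 : E3) 1,
        (Metric.ball (0 : E3) (R / 2)).indicator (fun y => ‖q y‖ₑ ^ 2) (0 + R • z)
      ≤ ‖R * ∫ z, φ z * q (0 + R • z) ^ 2‖ₑ := by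
    have hnn : ∀ z, 0 ≤ φ z * q (0 + R • z) ^ 2 := fun z => mul_nonneg φ.nonneg (sq_nonneg _)
    rw [enorm_mul, Real.enorm_of_nonneg hR.le, Real.enorm_of_nonneg (integral_nonneg hnn),
      ofReal_integral_eq_lintegral_ofReal _ (ae_of_all _ hnn)]
    · refine mul_le_mul_right ?_ _
      refine (setLIntegral_le_lintegral _ _).trans (lintegral_mono fun z => ?_)
      by_cases hz : ‖z‖ < 1 / 2
      · rw [Set.indicator_of_mem ((hmem z).2 hz),
          φ.one_of_mem_closedBall (mem_closedBall_zero_iff.2 hz.le), one_mul, ← Real.enorm_of_nonneg (sq_nonneg _), enorm_pow]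
      · rw [Set.indicator_of_notMem fun h => hz ((hmem z).1 h)]; exact zero_le
    · exact (hφ.continuous.mul ((hq.comp (by fun_prop)).pow 2)).integrable_of_hasCompactSupport
        hφc.mul_right
  refine hl.trans ?_
  rw [h, enorm_neg]
  refine (enorm_integral_le_lintegral_enorm _).trans ?_
  rw [← lintegral_const_mul' _ _ ENNReal.coe_ne_top,
    ← lintegral_indicator Metric.isOpen_ball.measurableSet]
  refine lintegral_mono fun z => ?_
  by_cases hz : z ∈ Metric.ball (0 : E3) 1
  · rw [Set.indicator_of_mem hz]
    by_cases hz2 : ‖z‖ < 1 / 2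
    · simp [hpd _ z hz2]
    · have hz3 : 0 + R • z ∈ (Metric.ball (0 : E3) (R / 2))ᶜ := fun h => hz2 ((hmem z).1 h)
      rw [Set.indicator_of_mem hz3]
      refine (enorm_sum_le _ _).trans ((Finset.sum_le_sum (g := fun _ => M * b (0 + R • z))
        fun j _ => ?_).trans (by simp [mul_assoc]))
      rw [enorm_mul]
      exact mul_le_mul' (hM j z) (hb j _)
  · simp [hpd' _ z hz]

/-- If `|H - a|` is bounded by the Riesz potential of `v × ω`, then the vorticity vanishes. -/
lemma curl_eq_zero {v : E3 → E3} (hv : ContDiff ℝ ∞ v) (hdiv : ∀ x, div v x = 0) {H : E3 → ℝ}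
    (hH : ContDiff ℝ ∞ H) (hHv : IsHead v H) (hv92 : ∫⁻ x, ‖v x‖ₑ ^ (9 / 2 : ℝ) ≠ ⊤)
    (hF : ∫⁻ x, (3 * (‖v x‖ₑ * ‖curl v x‖ₑ)) ^ (9 / 7 : ℝ) ≠ ⊤) {a : ℝ} {K : ℝ≥0}
    (ha : ∀ x, ‖H x - a‖ₑ ≤ K * riesz (fun y => 3 * (‖v y‖ₑ * ‖curl v y‖ₑ)) x) (x : E3) :
    curl v x = 0 := by
  have hv1 : ContDiff ℝ 1 v := hv.of_le (by simp)
  have hvc := hv.continuous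
  have hwc := (contDiff_curl hv).continuous
  set g : E3 → ℝ≥0 := fun y => 3 * (‖v y‖₊ * ‖curl v y‖₊) with hg
  have hgm : Measurable g := (hvc.measurable.nnnorm.mul hwc.measurable.nnnorm).const_mul 3
  have hg' : ∀ y, 3 * (‖v y‖ₑ * ‖curl v y‖ₑ) = (g y : ℝ≥0∞) := fun y => by
    simp [hg, enorm_eq_nnnorm]
  simp_rw [hg'] at hF ha
  obtain ⟨C, hC⟩ := exists_lintegral_mul_riesz_le
  obtain ⟨M, hM⟩ := exists_cutoff_bound
  set N := (∫⁻ x, (g x : ℝ≥0∞) ^ (9 / 7 : ℝ)) ^ (7 / 9 : ℝ) with hN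
  have hNfin : N ≠ ⊤ := ENNReal.rpow_ne_top_of_nonneg (by norm_num) hF
  set κ := volume (Metric.ball (0 : E3) 1) ^ (1 / 3 : ℝ)
  have hκ : κ ≠ ⊤ := ENNReal.rpow_ne_top_of_nonneg (by norm_num) measure_ball_lt_top.ne
  set T : ℝ → ℝ≥0∞ := fun R =>
    (∫⁻ x in (Metric.ball (0 : E3) (R / 2))ᶜ, ‖v x‖ₑ ^ (9 / 2 : ℝ)) ^ (2 / 9 : ℝ) with hT
  have hTlim : Tendsto T atTop (𝓝 0) := by
    have h := ((ENNReal.continuous_rpow_const (y := (2 / 9 : ℝ))).tendsto _).comp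
      (tendsto_lintegral_compl_ball (hvc.measurable.enorm.pow_const (9 / 2 : ℝ)) hv92)
    rwa [ENNReal.zero_rpow_of_pos (by norm_num)] at h
  -- The two summands come from v × ω and from (H - a)v. In the second the powers of R have already
  -- cancelled, and the decay comes only from the tail T R.
  set E : ℝ → ℝ≥0∞ := fun R => M * (ENNReal.ofReal (R ^ (2 : ℝ)) *
    avgBound (9 / 7) (fun y => (g y : ℝ≥0∞)) R + K * (C * (T R * κ) * N)) with hE
  have hElim : Tendsto E atTop (𝓝 0) := by
    -- The average decays like R^{-7/3}, which beats R².
    have h1 := tendsto_avgBound (p := 9 / 7) (by norm_num) hF (q := 2) (by norm_num)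
    have h2 : Tendsto (fun R => K * (C * (T R * κ) * N)) atTop (𝓝 0) := by
      have h3 := ENNReal.Tendsto.mul_const hTlim (Or.inr hκ)
      have h4 := ENNReal.Tendsto.const_mul (a := C) h3 (Or.inr ENNReal.coe_ne_top)
      have h5 := ENNReal.Tendsto.mul_const h4 (Or.inr hNfin)
      have h6 := ENNReal.Tendsto.const_mul (a := K) h5 (Or.inr ENNReal.coe_ne_top)
      simpa using h6
    have h7 := ENNReal.Tendsto.const_mul (a := M) (h1.add h2) (Or.inr ENNReal.coe_ne_top)
    simpa [hE] using h7
  have hmain : ∀ R : ℝ, 0 < R →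
      ∫⁻ y in Metric.ball (0 : E3) (R / 2), ‖curl v y‖ₑ ^ 2 ≤ E R := by
    intro R hR
    set S := Metric.ball (0 : E3) (R / 2)
    have hS : MeasurableSet S := Metric.isOpen_ball.measurableSet
    have h := hM (fun y => ‖curl v y‖) (fun j y => lamb v j y - (H y - a) * v y j)
      (fun y => g y + ‖H y - a‖ₑ * ‖v y‖ₑ) hwc.norm
      (fun j => ((contDiff_lamb hv j).of_le (by simp)).sub
        (((hH.of_le (by simp)).sub contDiff_const).mul (contDiff_comp hv1 j)))
      (fun x => sum_pd_energy hv hdiv hH hHv a x)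
      (fun j x => by
        refine enorm_sub_le.trans (add_le_add ?_ ?_)
        · rw [← hg']; exact enorm_lamb_le hv1 j x
        · rw [enorm_mul]; gcongr; exact enorm_comp_le _ _) R hR
    have hqm : Measurable (S.indicator fun y => ‖‖curl v y‖‖ₑ ^ 2) :=
      (hwc.norm.measurable.enorm.pow_const 2).indicator hS
    have hHm : Measurable fun y => ‖H y - a‖ₑ * ‖v y‖ₑ :=
      (hH.continuous.sub continuous_const).measurable.enorm.mul hvc.measurable.enorm
    rw [lintegral_ball_affine hqm 0 hR, lintegral_indicator hS, Measure.restrict_restrict hS,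
      Set.inter_eq_left.2 (Metric.ball_subset_ball (by linarith))] at h
    simp_rw [enorm_norm] at h
    set B := Metric.ball (0 : E3) R
    have hB : MeasurableSet B := Metric.isOpen_ball.measurableSet
    -- Restricting |v| to the shell puts it in L^{9/5}, dual to the potential of the L^{9/7}
    -- function g, with norm at most R times the L^{9/2} tail.
    set f : E3 → ℝ≥0 := (B ∩ Sᶜ).indicator fun y => ‖v y‖₊ with hf
    have hfm : Measurable f := hvc.measurable.nnnorm.indicator (hB.inter hS.compl)
    have hf95 : (∫⁻ x, (f x : ℝ≥0∞) ^ (9 / 5 : ℝ)) ^ (5 / 9 : ℝ)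
        ≤ T R * (ENNReal.ofReal R * κ) := by
      have h1 : ∫⁻ x, (f x : ℝ≥0∞) ^ (9 / 5 : ℝ) = ∫⁻ x in B ∩ Sᶜ, ‖v x‖ₑ ^ (9 / 5 : ℝ) := by
        rw [← lintegral_indicator (hB.inter hS.compl)]
        refine lintegral_congr fun x => ?_
        by_cases hx : x ∈ B ∩ Sᶜ
        · simp only [hf, Set.indicator_of_mem hx, enorm_eq_nnnorm]
        · simp only [hf, Set.indicator_of_notMem hx]
          simp
      rw [h1]
      exact rpow_lintegral_shell_le hvc hR.le
    have hshell : ∫⁻ y in B, Sᶜ.indicator (fun y => ‖H y - a‖ₑ * ‖v y‖ₑ) y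
        ≤ K * (C * (T R * (ENNReal.ofReal R * κ)) * N) := by
      calc ∫⁻ y in B, Sᶜ.indicator (fun y => ‖H y - a‖ₑ * ‖v y‖ₑ) y
          ≤ ∫⁻ y, K * (f y * riesz (fun y => g y) y) := by
            rw [← lintegral_indicator hB]
            refine lintegral_mono fun y => ?_
            rw [Set.indicator_indicator]
            by_cases hy : y ∈ B ∩ Sᶜ
            · rw [Set.indicator_of_mem hy, hf, Set.indicator_of_mem hy, mul_left_comm, mul_comm]
              exact mul_le_mul_right (ha y) _
            · rw [Set.indicator_of_notMem hy]; exact zero_le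
        _ = K * ∫⁻ y, f y * riesz (fun y => g y) y :=
            lintegral_const_mul' _ _ ENNReal.coe_ne_top
        _ ≤ K * (C * (∫⁻ x, (f x : ℝ≥0∞) ^ (9 / 5 : ℝ)) ^ (5 / 9 : ℝ) * N) := by
            gcongr; exact hC f g hfm hgm
        _ ≤ _ := by gcongr
    have hr : ∫⁻ z in Metric.ball (0 : E3) 1,
        Sᶜ.indicator (fun y => (g y : ℝ≥0∞) + ‖H y - a‖ₑ * ‖v y‖ₑ) (0 + R • z) ≤
        avgBound (9 / 7) (fun y => (g y : ℝ≥0∞)) R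
          + ENNReal.ofReal (R ^ (-3 : ℝ)) * (K * (C * (T R * (ENNReal.ofReal R * κ)) * N)) := by
      have haff : Measurable fun z : E3 => 0 + R • z := by fun_prop
      calc _ ≤ ∫⁻ z in Metric.ball (0 : E3) 1, ((g (0 + R • z) : ℝ≥0∞) +
            Sᶜ.indicator (fun y => ‖H y - a‖ₑ * ‖v y‖ₑ) (0 + R • z)) := by
            refine lintegral_mono fun z => ?_
            by_cases hz : 0 + R • z ∈ Sᶜ
            · rw [Set.indicator_of_mem hz, Set.indicator_of_mem hz]
            · rw [Set.indicator_of_notMem hz]; exact zero_le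
        _ = (∫⁻ z in Metric.ball (0 : E3) 1, (g (0 + R • z) : ℝ≥0∞)) +
            ∫⁻ z in Metric.ball (0 : E3) 1,
              Sᶜ.indicator (fun y => ‖H y - a‖ₑ * ‖v y‖ₑ) (0 + R • z) :=
            lintegral_add_left (hgm.coe_nnreal_ennreal.comp haff) _
        _ ≤ _ := by
            refine add_le_add (lintegral_ball_le_avgBound (by norm_num)
              (g := fun y => (g y : ℝ≥0∞)) hgm.coe_nnreal_ennreal 0 hR) ?_
            rw [lintegral_ball_affine (hHm.indicator hS.compl) 0 hR]
            gcongr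
    -- Multiplying by R² undoes the rescaling of the ball and the factor R from the cutoff
    -- inequality, since R² · R · R⁻³ = 1.
    have h8 := mul_le_mul_right (h.trans (mul_le_mul_right hr M)) (ENNReal.ofReal (R ^ (2 : ℝ)))
    have e1 : ENNReal.ofReal (R ^ (2 : ℝ)) * ENNReal.ofReal R * ENNReal.ofReal (R ^ (-3 : ℝ))
        = 1 := by
      rw [← ENNReal.ofReal_mul (by positivity), ← ENNReal.ofReal_mul (by positivity)]
      nth_rewrite 2 [← Real.rpow_one R]
      rw [← Real.rpow_add hR, ← Real.rpow_add hR]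
      norm_num
    calc ∫⁻ y in S, ‖curl v y‖ₑ ^ 2
        = (ENNReal.ofReal (R ^ (2 : ℝ)) * ENNReal.ofReal R * ENNReal.ofReal (R ^ (-3 : ℝ))) *
          ∫⁻ y in S, ‖curl v y‖ₑ ^ 2 := by rw [e1, one_mul]
      _ = ENNReal.ofReal (R ^ (2 : ℝ)) * (ENNReal.ofReal R * (ENNReal.ofReal (R ^ (-3 : ℝ)) *
          ∫⁻ y in S, ‖curl v y‖ₑ ^ 2)) := by ring
      _ ≤ _ := h8
      _ = M * (ENNReal.ofReal (R ^ (2 : ℝ)) * avgBound (9 / 7) (fun y => (g y : ℝ≥0∞)) R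
          + (ENNReal.ofReal (R ^ (2 : ℝ)) * ENNReal.ofReal R * ENNReal.ofReal (R ^ (-3 : ℝ))) *
            (K * (C * (T R * κ) * N))) := by ring
      _ = E R := by rw [e1, one_mul]
  have hzero : ∫⁻ y, ‖curl v y‖ₑ ^ 2 = 0 := by
    have hr : Tendsto (fun n : ℕ => (n : ℝ) / 2) atTop atTop :=
      tendsto_natCast_atTop_atTop.atTop_div_const (by norm_num)
    have hlim := (aecover_ball (μ := (volume : Measure E3)) (x := 0) hr).lintegral_tendsto_of_nat
      (hwc.measurable.enorm.pow_const 2).aemeasurable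
    refine le_antisymm (le_of_tendsto_of_tendsto hlim (hElim.comp tendsto_natCast_atTop_atTop) ?_)
      zero_le
    filter_upwards [eventually_gt_atTop 0] with n hn
    exact hmain n (by exact_mod_cast hn)
  rw [lintegral_eq_zero_iff (hwc.measurable.enorm.pow_const 2)] at hzero
  have hae : curl v =ᵐ[volume] fun _ => 0 := by
    filter_upwards [hzero] with y hy
    simpa using hy
  exact congrFun ((Continuous.ae_eq_iff_eq volume hwc continuous_const).1 hae) x

/-- The Liouville theorem. -/
theorem eq_zero_of_isSmoothStationarySolution {v : E3 → E3} {p : E3 → ℝ}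
    (h : IsSmoothStationarySolution v p) (hvan : VanishesAtInfinity v)
    (hL : MemLp (curl v) (9 / 5) volume) (x : E3) : v x = 0 := by
  have hv := h.smooth_velocity
  have hvc := hv.continuous
  have hwc := (contDiff_curl hv).continuous
  obtain ⟨C, hC⟩ := exists_potential_bounds
  obtain ⟨hv92, -, -⟩ := hC v hv h.div_free hvan hL
  have hwtop := hL.eLpNorm_lt_top
  have hvtop : eLpNorm v (9 / 2) volume < ⊤ :=
    hv92.trans_lt (ENNReal.mul_lt_top ENNReal.coe_lt_top hwtop)
  rw [eLpNorm_nine_fifths] at hwtop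
  rw [eLpNorm_nine_halves] at hvtop
  have hfin : ∀ {I : ℝ≥0∞} {q : ℝ}, 0 < q → I ^ q < ⊤ → I ≠ ⊤ := fun hq h hI => by
    rw [hI, ENNReal.top_rpow_of_pos hq] at h; exact lt_irrefl _ h
  have hF0 := hfin (by norm_num) ((rpow_mul_enorm_le hvc hwc).trans_lt
    (ENNReal.mul_lt_top hvtop hwtop))
  have hF : ∫⁻ x, (3 * (‖v x‖ₑ * ‖curl v x‖ₑ)) ^ (9 / 7 : ℝ) ≠ ⊤ := by
    simp_rw [fun x => ENNReal.mul_rpow_of_nonneg 3 (‖v x‖ₑ * ‖curl v x‖ₑ) (z := (9 / 7 : ℝ))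
      (by norm_num)]
    have h3 : (3 : ℝ≥0∞) ^ (9 / 7 : ℝ) ≠ ⊤ := ENNReal.rpow_ne_top_of_nonneg (by norm_num) (by simp)
    rw [lintegral_const_mul' _ _ h3]
    exact ENNReal.mul_ne_top h3 hF0
  obtain ⟨H, hH, hHv⟩ := h.exists_isHead
  obtain ⟨b, hb⟩ := exists_const_of_enorm_sub_le (h := fun x => mass * H x)
    (G := riesz (fun y => 3 * (‖v y‖ₑ * ‖curl v y‖ₑ)))
    (fun ε hε => by
      have hg' : ∀ y, 3 * (‖v y‖ₑ * ‖curl v y‖ₑ)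
          = ((3 * (‖v y‖₊ * ‖curl v y‖₊) : ℝ≥0) : ℝ≥0∞) := fun y => by simp [enorm_eq_nnnorm]
      simp_rw [hg'] at hF ⊢
      exact exists_riesz_le
        ((hvc.measurable.nnnorm.mul hwc.measurable.nnnorm).const_mul 3) hF hε)
    (fun x x' => by
      rw [← mul_sub]
      exact enorm_head_sub_le hv hH hHv (hfin (by norm_num) hwtop) hF x x')
  have ha : ∀ x, ‖H x - b / mass‖ₑ
      ≤ potConst * riesz (fun y => 3 * (‖v y‖ₑ * ‖curl v y‖ₑ)) x := fun x => by
    -- The spare factor 3 is not needed for the scalar H and is discarded.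
    refine le_trans ?_ (enorm_le_of_mass_mul (t := H x - b / mass) ?_)
    · exact le_mul_of_one_le_left zero_le (by norm_num)
    · rw [mul_sub, mul_div_cancel₀ _ mass_pos.ne']
      exact hb x
  have hω := curl_eq_zero hv h.div_free hH hHv (hfin (by norm_num) hvtop) hF ha
  have hx := enorm_velocity_le hv h.div_free hvan x
  simp_rw [hω, enorm_zero] at hx
  rw [riesz_zero, mul_zero] at hx
  simpa using hx

end NavierStokes

end

theorem mainTheorem4 :
    (∀ (v : E3 → E3) (p : E3 → ℝ),
      NavierStokes.IsSmoothStationarySolution v p →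
      NavierStokes.VanishesAtInfinity v →
      MemLp (NavierStokes.curl v) (9 / 5) volume →
      ∀ x, v x = 0) ∧
    (∃ C : ℝ≥0, ∀ v : E3 → E3,
      ContDiff ℝ ∞ v →
      (∀ x, NavierStokes.div v x = 0) →
      NavierStokes.VanishesAtInfinity v →
      MemLp (NavierStokes.curl v) (9 / 5) volume →
      eLpNorm v (9 / 2) volume ≤ C * eLpNorm (NavierStokes.curl v) (9 / 5) volume ∧
      Integrable (fun z : E3 × E3 => NavierStokes.Phi v z.1 z.2) (volume.prod volume) ∧
      ∫⁻ x, ∫⁻ y, ‖NavierStokes.Phi v x y‖ₑ ≤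
        C * eLpNorm (NavierStokes.curl v) (9 / 5) volume ^ 3) :=
  ⟨fun _ _ h hvan hL => NavierStokes.eq_zero_of_isSmoothStationarySolution h hvan hL,
    NavierStokes.exists_potential_bounds⟩
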